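/- Let $p$ be a prime number, let $I\in\mathbb{N}\cup\{\infty\}$, let $k$ be a perfect field of characteristic $p$, and let $\Gamma$ be a $p$-divisible (totally) ordered abelian group; if $I\neq 0$, assume that $\Gamma$ is nontrivial. Then there exists a valued field $(K,v)$ of characteristic $p$ that is separably tame and of elementary imperfection degree $I$, whose residue field is isomorphic to $k$ and whose value group is isomorphic to $\Gamma$ as an ordered group. Here a valued field $(K,v)$ is *separably tame* if it is henselian, its residue field $Kv$ is perfect, its value group $vK$ is $q$-divisible, where $q$ is the characteristic exponent of $Kv$, and it is separably defectless, i.e. $[F:K]=(vF:vK)\cdot[Fv:Kv]$ for every finite separable extension $F/K$, where $F$ carries the unique extension of $v$. A subset $S\subseteq K$ is a *$p$-basis* of $K$ if $K=K^{(p)}(S)$ and $a\notin K^{(p)}(S\setminus\{a\})$ for all $a\in S$, where $K^{(p)}$ is the field of $p$-th powers; all $p$-bases have the same cardinality. The *elementary imperfection degree* of $K$ is this cardinality if it is finite, and $\infty$ otherwise. -/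

import Mathlib

universe u v w

namespace SepTame

section Imperfection

variable {K : Type u} [Field K]

/-- The subfield `K^(p)(S)` of `K` generated by the `p`-th powers of `K` and the set `S`. -/
def pSpan (p : ℕ) (S : Set K) : Subfield K :=
  Subfield.closure (Set.range (fun x : K => x ^ p) ∪ S)

/-- `S` is `p`-independent: no `a ∈ S` lies in `K^(p)(S \ {a})`. -/
def IsPIndependent (p : ℕ) (S : Set K) : Prop :=
  ∀ a ∈ S, a ∉ pSpan p (S \ {a})

/-- `S` is a `p`-basis of `K`: it is `p`-independent and `K = K^(p)(S)`. -/
def IsPBasis (p : ℕ) (S : Set K) : Prop :=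
  IsPIndependent p S ∧ pSpan p S = ⊤

/-- The field `K` of characteristic `p` has elementary imperfection degree `I ∈ ℕ ∪ {∞}`:
a `p`-basis of `K` has exactly `I` elements if `I` is finite, and is infinite if `I = ∞`.
(All `p`-bases of `K` have the same cardinality; `Set.encard` sends every infinite
cardinality to `⊤`.) -/
def HasElementaryImperfectionDegree (K : Type u) [Field K] (p : ℕ) (I : ℕ∞) : Prop :=
  ∃ S : Set K, IsPBasis p S ∧ S.encard = I

end Imperfection

section Extensions

variable {K : Type u} [Field K] {F : Type v} [Field F] [Algebra K F]

/-- The valuation ring `B` of `F` lies over the valuation ring `A` of `K`, that is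
`B ∩ K = A`: the valuation of `B` extends that of `A`. -/
def LiesOver (A : ValuationSubring K) (B : ValuationSubring F) : Prop :=
  B.comap (algebraMap K F) = A

/-- The inclusion `A → B` of valuation rings, for `B` lying over `A`. -/
def ringMap (A : ValuationSubring K) (B : ValuationSubring F) (h : LiesOver A B) : A →+* B :=
  ((algebraMap K F).comp A.subtype).codRestrict B.toSubring (fun x => by
    have hx : (x : K) ∈ B.comap (algebraMap K F) := by
      rw [show B.comap (algebraMap K F) = A from h]; exact x.2
    exact hx)

theorem ringMap_isLocalHom (A : ValuationSubring K) (B : ValuationSubring F)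
    (h : LiesOver A B) : IsLocalHom (ringMap A B h) := by
  constructor
  intro a ha
  obtain ⟨b, hb⟩ := isUnit_iff_exists_inv.mp ha
  have hb' : algebraMap K F (a : K) * (b : F) = 1 := congrArg Subtype.val hb
  have hbe : algebraMap K F ((a : K)⁻¹) = (b : F) := by
    rw [map_inv₀]; exact inv_eq_of_mul_eq_one_right hb'
  have ha0 : (a : K) ≠ 0 := by
    intro h0; rw [h0] at hb'; simp at hb'
  have hmem : (a : K)⁻¹ ∈ A := by
    have hm : (a : K)⁻¹ ∈ B.comap (algebraMap K F) := by
      rw [ValuationSubring.mem_comap, hbe]; exact b.2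
    rwa [show B.comap (algebraMap K F) = A from h] at hm
  exact isUnit_iff_exists_inv.mpr ⟨⟨(a : K)⁻¹, hmem⟩, Subtype.ext (mul_inv_cancel₀ ha0)⟩

/-- The embedding of the residue field of `A` in that of `B`, for `B` lying over `A`. -/
noncomputable def residueMap (A : ValuationSubring K) (B : ValuationSubring F)
    (h : LiesOver A B) : IsLocalRing.ResidueField A →+* IsLocalRing.ResidueField B :=
  haveI := ringMap_isLocalHom A B h
  IsLocalRing.ResidueField.map (ringMap A B h)

/-- The inertia degree: the degree of the residue field extension (`0` if infinite). -/
noncomputable def inertiaDegree (A : ValuationSubring K) (B : ValuationSubring F)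
    (h : LiesOver A B) : ℕ :=
  letI := (residueMap A B h).toAlgebra
  Module.finrank (IsLocalRing.ResidueField A) (IsLocalRing.ResidueField B)

/-- The ramification index: the index of the value group of `K`, which is the image of
`Kˣ` in `Fˣ / Bˣ`, in the value group `Fˣ / Bˣ` of `F` (`0` if infinite). -/
noncomputable def ramificationIndex (K : Type u) [Field K] {F : Type v} [Field F] [Algebra K F]
    (B : ValuationSubring F) : ℕ :=
  ((Units.map (algebraMap K F : K →* F)).range ⊔ B.unitGroup).index

end Extensions

/-- Separable defectlessness of a henselian valued field, given by its valuation ring `A`: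
every finite separable extension `F/K`, with the (unique) extension of the valuation,
satisfies `[F : K] = e * f`. -/
def IsSeparablyDefectless {K : Type u} [Field K] (A : ValuationSubring K) : Prop :=
  ∀ (F : Type u) [Field F] [Algebra K F], FiniteDimensional K F → Algebra.IsSeparable K F →
    ∀ (B : ValuationSubring F) (h : LiesOver A B),
      Module.finrank K F = ramificationIndex K B * inertiaDegree A B h

/-- A separably tame valued field, given by its valuation ring `A`: a henselian, separably
defectless valued field with perfect residue field and `q`-divisible value group, where `q` is
the characteristic exponent of the residue field. The value group is written multiplicatively,
with a zero adjoined. -/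
structure IsSeparablyTame {K : Type u} [Field K] (A : ValuationSubring K) : Prop where
  henselian : HenselianLocalRing A
  separablyDefectless : IsSeparablyDefectless A
  perfect_residueField : PerfectField (IsLocalRing.ResidueField A)
  divisible_valueGroup : ∀ γ : A.ValueGroup, ∃ δ : A.ValueGroup,
    δ ^ ringExpChar (IsLocalRing.ResidueField A) = γ

/-- The valuation ring `{x | 0 ≤ v x}` of a field with an additively written valuation. -/
def valuationRing {K : Type u} [Field K] {Γ : Type w} [AddCommGroup Γ] [LinearOrder Γ]
    [IsOrderedAddMonoid Γ] (v : AddValuation K (WithTop Γ)) : ValuationSubring K where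
  carrier := {x | 0 ≤ v x}
  mul_mem' {a b} ha hb := by
    change 0 ≤ v (a * b); rw [v.map_mul]; exact add_nonneg ha hb
  one_mem' := by change 0 ≤ v 1; rw [v.map_one]
  add_mem' {a b} ha hb := v.map_le_add ha hb
  zero_mem' := by change 0 ≤ v 0; rw [v.map_zero]; exact le_top
  neg_mem' {a} ha := by change 0 ≤ v (-a); rw [v.map_neg]; exact ha
  mem_or_inv_mem' a := by
    change 0 ≤ v a ∨ 0 ≤ v a⁻¹
    rcases eq_or_ne a 0 with rfl | ha
    · left; rw [v.map_zero]; exact le_top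
    · by_contra hc
      push Not at hc
      have h1 : v a + v a⁻¹ = 0 := by rw [← v.map_mul, mul_inv_cancel₀ ha, v.map_one]
      have h2 : v a + v a⁻¹ ≤ v a := add_le_of_nonpos_right hc.2.le
      rw [h1] at h2
      exact absurd h2 (not_le.mpr hc.1)

end SepTame

/-!
The field is found inside the Hahn series field `L = k((Γ))`, which is perfect, as `k` is perfect
and `Γ` is `p`-divisible. It has a subfield `K` such that `L / K` is purely
inseparable, the elementary imperfection degree of `K` is `I`, and `K` has the value group and the
residue field of `L`; the properties of separably tame fields then descend from `L` to `K`.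

*The field `K`.* If `Γ` is nontrivial then `L` is uncountable, so a transcendence basis of `L` over
the prime field is infinite, and has a subset `X` with `I` elements. Let `P` be the relative
algebraic closure in `L` of the field generated by the rest of the basis; it is perfect. Let `K` be
the relative separable closure of `P(X)` in `L`. Then `L / K` is purely inseparable and `X` is a
`p`-basis of `K` (`hasElementaryImperfectionDegree_separableClosure`).

*Value group and residue field.* If `I = 0` then `K` is perfect and equal to `L`. Otherwise `Γ` is
nontrivial, and every leading monomial `m` of `L` is attained on `K`: some `m ^ q`
lies in `K`, with `q` a power of `p`, and for a monomial `d ∈ K` of value larger than that of `m`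
the separable polynomial `X ^ q - d ^ (q - 1) X - m ^ q` has a root `m + d w` in `L`, hence in `K`,
where `w` is an explicit solution of the Artin--Schreier equation `w ^ q - w = m / d`
(`exists_lt_orderTop_algebraMap_sub`).

*The field `L`.* Hahn series fields are maximally complete (`isMaximallyComplete_hahnSeries`). A
maximally complete field is henselian (`IsMaximallyComplete.henselianLocalRing`) and every finite
extension `M` satisfies `[M : L] = e f` (`IsMaximallyComplete.finrank_eq`).

*Descent.* Simple roots are separable over `K`, so they lie in `K`, and `K` is henselian. For a
finite separable extension `F / K` the compositum `M` of `F` and `L` has degree `[F : K]` over `L`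
and is purely inseparable over `F`, so it carries one extension of each valuation of `F`. As the
value group and the residue field of `K` are those of `L`, where `L` is perfect, the ramification
index and the inertia degree of `F / K` and of `M / L` agree, and so does the fundamental equality
(`isSeparablyDefectless_of_isPurelyInseparable`).
-/

/-! ### Valuation independence -/

namespace SepTame

section ValuationIndependence

variable {L : Type*} [Field L] {M : Type*} [Field M] [Algebra L M]
  {A : ValuationSubring L} {B : ValuationSubring M}

theorem LiesOver.algebraMap_mem_iff (h : LiesOver A B) {x : L} :
    algebraMap L M x ∈ B ↔ x ∈ A := by
  rw [← ValuationSubring.mem_comap, show B.comap (algebraMap L M) = A from h]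

theorem LiesOver.valuation_le_iff (h : LiesOver A B) {x y : L} :
    B.valuation (algebraMap L M x) ≤ B.valuation (algebraMap L M y) ↔
      A.valuation x ≤ A.valuation y := by
  rcases eq_or_ne y 0 with rfl | hy
  · simp
  have h1 : 0 < B.valuation (algebraMap L M y) := zero_lt_iff.mpr (by simpa using hy)
  have h2 : 0 < A.valuation y := zero_lt_iff.mpr (by simpa using hy)
  rw [← div_le_one₀ h1, ← div_le_one₀ h2, ← map_div₀ B.valuation, ← map_div₀ (algebraMap L M),
    ← map_div₀ A.valuation, ValuationSubring.valuation_le_one_iff,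
    ValuationSubring.valuation_le_one_iff, h.algebraMap_mem_iff]

theorem LiesOver.valuation_lt_iff (h : LiesOver A B) {x y : L} :
    B.valuation (algebraMap L M x) < B.valuation (algebraMap L M y) ↔
      A.valuation x < A.valuation y := by
  rw [← not_le, h.valuation_le_iff, not_le]

@[simp]
theorem coe_ringMap (h : LiesOver A B) (a : A) : (ringMap A B h a : M) = algebraMap L M a := rfl

theorem residueMap_residue (h : LiesOver A B) (a : A) :
    residueMap A B h (IsLocalRing.residue A a) = IsLocalRing.residue B (ringMap A B h a) := rfl

theorem valuation_eq_one_of_residue_ne_zero {b : B} (hb : IsLocalRing.residue B b ≠ 0) :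
    B.valuation b = 1 := by
  rw [← ValuationSubring.valuation_eq_one_iff]
  exact (IsLocalRing.residue_ne_zero_iff_isUnit b).mp hb

theorem valuation_lt_one_of_residue_eq_zero {b : B} (hb : IsLocalRing.residue B b = 0) :
    B.valuation b < 1 := by
  rw [← ValuationSubring.valuation_lt_one_iff]
  exact (IsLocalRing.residue_eq_zero_iff b).mp hb

variable {ι τ : Type*} {b : ι → B} {c : τ → M}

/-- Elements of `B` with linearly independent residues: a nontrivial combination with
coefficients in `L` has the valuation of its largest coefficient. -/
theorem exists_valuation_sum_eq (h : LiesOver A B) {s : Finset ι}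
    (hb : ∀ g : ι → IsLocalRing.ResidueField A,
      ∑ i ∈ s, residueMap A B h (g i) * IsLocalRing.residue B (b i) = 0 → ∀ i ∈ s, g i = 0)
    (a : ι → L) :
    (∀ i ∈ s, a i = 0) ∨ ∃ i₀ ∈ s, a i₀ ≠ 0 ∧
      B.valuation (∑ i ∈ s, algebraMap L M (a i) * b i) = B.valuation (algebraMap L M (a i₀)) ∧
      ∀ i ∈ s, B.valuation (algebraMap L M (a i)) ≤ B.valuation (algebraMap L M (a i₀)) := by
  by_cases h0 : ∀ i ∈ s, a i = 0
  · exact Or.inl h0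
  right
  push Not at h0
  obtain ⟨i₁, hi₁, hai₁⟩ := h0
  obtain ⟨i₀, hi₀, hmax⟩ := s.exists_max_image (fun i => B.valuation (algebraMap L M (a i)))
    ⟨i₁, hi₁⟩
  have hai₀ : a i₀ ≠ 0 := by
    intro h0
    have := hmax i₁ hi₁
    simp [h0, hai₁] at this
  refine ⟨i₀, hi₀, hai₀, ?_, hmax⟩
  have hg : ∀ i, ∃ g : A, i ∈ s → (g : L) * a i₀ = a i := by
    intro i
    by_cases hi : i ∈ s
    · obtain ⟨g, hg⟩ := (A.valuation_le_iff (a i) (a i₀)).mp (h.valuation_le_iff.mp (hmax i hi))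
      exact ⟨g, fun _ => hg⟩
    · exact ⟨0, fun hi' => absurd hi' hi⟩
  choose g hg using hg
  have hsum : ∑ i ∈ s, algebraMap L M (a i) * b i =
      algebraMap L M (a i₀) * ((∑ i ∈ s, ringMap A B h (g i) * b i : B) : M) := by
    push_cast
    rw [Finset.mul_sum]
    refine Finset.sum_congr rfl fun i hi => ?_
    rw [coe_ringMap, ← hg i hi, map_mul]
    ring
  have hunit : B.valuation ((∑ i ∈ s, ringMap A B h (g i) * b i : B) : M) = 1 := by
    refine valuation_eq_one_of_residue_ne_zero fun hzero => ?_
    have := hb (fun i => IsLocalRing.residue A (g i)) (by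
      simpa [residueMap_residue, map_sum] using hzero) i₀ hi₀
    have hgi : g i₀ = 1 := Subtype.ext (mul_right_cancel₀ hai₀ (by simpa using hg i₀ hi₀))
    simp [hgi] at this
  rw [hsum, map_mul, hunit, mul_one]

/-- Valuation independence of the products `b i * c j`, where the `b i` have linearly independent
residues and the `c j` have values in distinct classes modulo the value group of `L`. -/
theorem valuation_le_valuation_sum (h : LiesOver A B) {s : Finset ι} {t : Finset τ}
    (hb : ∀ g : ι → IsLocalRing.ResidueField A,
      ∑ i ∈ s, residueMap A B h (g i) * IsLocalRing.residue B (b i) = 0 → ∀ i ∈ s, g i = 0)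
    (hc : ∀ j j' (l : L), l ≠ 0 →
      B.valuation (c j) = B.valuation (algebraMap L M l) * B.valuation (c j') → j = j')
    (a : ι → τ → L) {i : ι} {j : τ} (hi : i ∈ s) (hj : j ∈ t) :
    B.valuation (algebraMap L M (a i j) * c j) ≤
      B.valuation (∑ j ∈ t, (∑ i ∈ s, algebraMap L M (a i j) * b i) * c j) := by
  classical
  set S : τ → M := fun j => ∑ i ∈ s, algebraMap L M (a i j) * b i with hS
  have key : ∀ j, (∀ i ∈ s, a i j = 0) ∨ ∃ i₀ ∈ s, a i₀ j ≠ 0 ∧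
      B.valuation (S j) = B.valuation (algebraMap L M (a i₀ j)) ∧
      ∀ i ∈ s, B.valuation (algebraMap L M (a i j)) ≤ B.valuation (algebraMap L M (a i₀ j)) :=
    fun j => exists_valuation_sum_eq h hb (fun i => a i j)
  have hle : B.valuation (algebraMap L M (a i j) * c j) ≤ B.valuation (S j * c j) := by
    rw [map_mul, map_mul]
    gcongr
    rcases key j with h0 | ⟨i₀, -, -, h1, h2⟩
    · simp [h0 i hi]
    · rw [h1]; exact h2 i hi
  obtain ⟨j₀, hj₀, hmax⟩ := t.exists_max_image (fun j => B.valuation (S j * c j)) ⟨j, hj⟩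
  refine (hle.trans (hmax j hj)).trans ?_
  rcases eq_or_ne (B.valuation (S j₀ * c j₀)) 0 with h0 | h0
  · rw [h0]; exact zero_le
  refine (Valuation.map_sum_eq_of_lt B.valuation hj₀ fun j' hj' => ?_).ge
  rw [Finset.mem_sdiff, Finset.mem_singleton] at hj'
  refine lt_of_le_of_ne (hmax j' hj'.1) fun heq => hj'.2 ?_
  change B.valuation (S j' * c j') = B.valuation (S j₀ * c j₀) at heq
  have hS0 : S j₀ ≠ 0 := fun h1 => h0 (by simp [h1])
  have hS' : S j' ≠ 0 := fun h1 => h0 (by rw [← heq, h1, zero_mul, map_zero])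
  have aux : ∀ j, S j ≠ 0 → ∃ l : L, l ≠ 0 ∧ B.valuation (S j) = B.valuation (algebraMap L M l) := by
    intro j hj
    rcases key j with h0 | ⟨i₀, -, h1, h2, -⟩
    · exact absurd (Finset.sum_eq_zero fun i hi => by simp [h0 i hi]) hj
    · exact ⟨_, h1, h2⟩
  obtain ⟨l, hl, hlS⟩ := aux j₀ hS0
  obtain ⟨l', hl', hlS'⟩ := aux j' hS'
  refine hc j' j₀ (l / l') (div_ne_zero hl hl') ?_
  have hl'' : B.valuation (algebraMap L M l') ≠ 0 := by simpa using hl'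
  rw [map_mul, map_mul, hlS, hlS'] at heq
  rw [map_div₀, map_div₀, div_mul_eq_mul_div, eq_div_iff hl'', mul_comm, heq]

end ValuationIndependence

end SepTame

/-! ### Maximally complete fields are defectless -/

namespace SepTame

/-- A valuation ring `A` of a field `L` is maximally complete if every consistent system of
congruences `y ≡ x mod N`, with `N` an `A`-submodule of `L`, is solvable. As the submodules
are totally ordered by inclusion, this says that every chain of generalized balls `x + N`
has a common point. -/
def IsMaximallyComplete {L : Type u} [Field L] (A : ValuationSubring L) : Prop :=
  ∀ C : Set (L × Submodule A L), (∀ c ∈ C, ∀ c' ∈ C, c.1 - c'.1 ∈ c.2 ⊔ c'.2) →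
    ∃ y, ∀ c ∈ C, y - c.1 ∈ c.2

theorem IsMaximallyComplete.exists_forall_sub_mem {L : Type u} [Field L] {A : ValuationSubring L}
    (hA : IsMaximallyComplete A) {ι : Type*} (x : ι → L) (N : ι → Submodule A L)
    (hx : ∀ i j, x i - x j ∈ N i ⊔ N j) : ∃ y, ∀ i, y - x i ∈ N i := by
  obtain ⟨y, hy⟩ := hA (Set.range fun i => (x i, N i)) (by
    rintro _ ⟨i, rfl⟩ _ ⟨j, rfl⟩
    exact hx i j)
  exact ⟨y, fun i => hy _ ⟨i, rfl⟩⟩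

section Defectless

variable {L : Type u} [Field L] {M : Type v} [Field M] [Algebra L M]
  {A : ValuationSubring L} {B : ValuationSubring M}

theorem mem_range_sup_unitGroup_iff {x : Mˣ} :
    x ∈ (Units.map (algebraMap L M : L →* M)).range ⊔ B.unitGroup ↔
      ∃ l : L, l ≠ 0 ∧ B.valuation (x : M) = B.valuation (algebraMap L M l) := by
  rw [Subgroup.mem_sup]
  constructor
  · rintro ⟨_, ⟨l, rfl⟩, z, hz, rfl⟩
    refine ⟨l, l.ne_zero, ?_⟩
    rw [ValuationSubring.mem_unitGroup_iff] at hz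
    simp [hz]
  · rintro ⟨l, hl, h⟩
    refine ⟨_, ⟨Units.mk0 l hl, rfl⟩, (Units.map (algebraMap L M : L →* M) (Units.mk0 l hl))⁻¹ * x,
      ?_, by simp⟩
    rw [ValuationSubring.mem_unitGroup_iff]
    have : B.valuation (algebraMap L M l) ≠ 0 := by simpa using hl
    simp [h, this]

/-- A finite extension of a maximally complete valued field satisfies the fundamental equality.
The products of lifts of a residue basis with representatives of the value classes are linearly
independent; an element outside of their span would have a best approximation in the span, by
maximal completeness applied to the coordinates, but every approximation can be improved. -/
theorem IsMaximallyComplete.finrank_eq [FiniteDimensional L M] (hA : IsMaximallyComplete A)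
    (h : LiesOver A B) :
    Module.finrank L M = ramificationIndex L B * inertiaDegree A B h := by
  classical
  let _ := (residueMap A B h).toAlgebra
  set H := (Units.map (algebraMap L M : L →* M)).range ⊔ B.unitGroup with hH
  let bas := Module.Free.chooseBasis (IsLocalRing.ResidueField A) (IsLocalRing.ResidueField B)
  let ι := Module.Free.ChooseBasisIndex (IsLocalRing.ResidueField A) (IsLocalRing.ResidueField B)
  let τ := Mˣ ⧸ H
  obtain ⟨b, hb⟩ : ∃ b : ι → B, ∀ i, IsLocalRing.residue B (b i) = bas i :=
    ⟨fun i => (IsLocalRing.residue_surjective (bas i)).choose,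
      fun i => (IsLocalRing.residue_surjective (bas i)).choose_spec⟩
  let c : τ → M := fun j => (Quotient.out j : Mˣ)
  have hb' : ∀ (s : Finset ι) (g : ι → IsLocalRing.ResidueField A),
      ∑ i ∈ s, residueMap A B h (g i) * IsLocalRing.residue B (b i) = 0 → ∀ i ∈ s, g i = 0 := by
    intro s g hg
    refine linearIndependent_iff'.mp bas.linearIndependent s g ?_
    simp only [hb] at hg
    exact hg
  have hc0 : ∀ j, c j ≠ 0 := fun j => Units.ne_zero _
  have hcmem : ∀ x : Mˣ, ∃ l : L, l ≠ 0 ∧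
      B.valuation (x : M) = B.valuation (algebraMap L M l) * B.valuation (c x) := by
    intro x
    have hx : (Quotient.out (x : τ))⁻¹ * x ∈ H := by
      rw [← QuotientGroup.eq]; exact Quotient.out_eq (x : τ)
    obtain ⟨l, hl, hlx⟩ := mem_range_sup_unitGroup_iff.mp hx
    refine ⟨l, hl, ?_⟩
    have : B.valuation (c x) ≠ 0 := by simpa using hc0 x
    rw [← hlx]
    simp only [Units.val_mul, map_mul]
    rw [mul_comm, ← mul_assoc, ← map_mul]
    simp [c]
  have hc : ∀ j j' (l : L), l ≠ 0 →
      B.valuation (c j) = B.valuation (algebraMap L M l) * B.valuation (c j') → j = j' := by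
    intro j j' l hl hv
    rw [← Quotient.out_eq j, ← Quotient.out_eq j']
    refine (QuotientGroup.eq.mpr ?_).symm
    refine mem_range_sup_unitGroup_iff.mpr ⟨l, hl, ?_⟩
    have : B.valuation (c j') ≠ 0 := by simpa using hc0 j'
    rw [Units.val_mul, map_mul, show ((Quotient.out j : Mˣ) : M) = c j from rfl, hv, mul_comm,
      mul_assoc, ← map_mul]
    simp [c]
  have hli : LinearIndependent L (fun x : ι × τ => (b x.1 : M) * c x.2) := by
    rw [linearIndependent_iff']
    intro r g hg x hx
    let a : ι → τ → L := fun i j => if (i, j) ∈ r then g (i, j) else 0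
    have hsub : r ⊆ r.image Prod.fst ×ˢ r.image Prod.snd := fun y hy =>
      Finset.mem_product.mpr ⟨Finset.mem_image_of_mem _ hy, Finset.mem_image_of_mem _ hy⟩
    have h0 : ∑ j ∈ r.image Prod.snd,
        (∑ i ∈ r.image Prod.fst, algebraMap L M (a i j) * b i) * c j = 0 := by
      rw [← hg]
      simp_rw [Finset.sum_mul]
      rw [Finset.sum_comm, ← Finset.sum_product']
      symm
      refine Finset.sum_subset_zero_on_sdiff hsub ?_ ?_
      · intro y hy
        simp [a, (Finset.mem_sdiff.mp hy).2]
      · intro y hy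
        simp [a, hy, Algebra.smul_def, mul_assoc]
    have := valuation_le_valuation_sum h (hb' _) hc a
      (Finset.mem_image_of_mem Prod.fst hx) (Finset.mem_image_of_mem Prod.snd hx)
    rw [h0] at this
    simpa [a, hx, hc0] using this
  have hfin : Finite (ι × τ) := hli.finite
  have hne : Nonempty (ι × τ) := ⟨⟨bas.index_nonempty.some, ((1 : Mˣ) : τ)⟩⟩
  have : Finite ι := Finite.prod_left τ
  have : Finite τ := Finite.prod_right ι
  cases nonempty_fintype ι
  cases nonempty_fintype τ
  -- the element of the span with the coefficients `a`
  let W : (ι → τ → L) → M := fun a => ∑ j, (∑ i, algebraMap L M (a i j) * b i) * c j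
  have hWsub : ∀ a a', W a - W a' = W (a - a') := by
    intro a a'
    simp only [W, ← Finset.sum_sub_distrib, ← sub_mul, Pi.sub_apply, map_sub]
  have hWle : ∀ a i j, B.valuation (algebraMap L M (a i j) * c j) ≤ B.valuation (W a) :=
    fun a i j => valuation_le_valuation_sum h (hb' _) hc a (Finset.mem_univ i)
      (Finset.mem_univ j)
  have hWge : ∀ a γ, (∀ i j, B.valuation (algebraMap L M (a i j) * c j) ≤ γ) →
      B.valuation (W a) ≤ γ := by
    intro a γ ha
    refine Valuation.map_sum_le _ fun j _ => ?_
    rw [Finset.sum_mul]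
    refine Valuation.map_sum_le _ fun i _ => le_trans ?_ (ha i j)
    rw [mul_right_comm, map_mul]
    exact mul_le_of_le_one_right' (B.valuation_le_one (b i))
  have hspan : ∀ y : M, ∃ a, W a = y := by
    intro y
    by_contra! hy
    obtain ⟨a₀, ha₀⟩ : ∃ a₀ : ι → τ → L, ∀ a, B.valuation (y - W a₀) ≤ B.valuation (y - W a) := by
      have hex : ∀ i j, ∃ z : L, ∀ a : ι → τ → L,
          B.valuation (algebraMap L M (z - a i j) * c j) ≤ B.valuation (y - W a) := by
        intro i j
        let N : (ι → τ → L) → Submodule A L := fun a =>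
          { carrier := {z | B.valuation (algebraMap L M z * c j) ≤ B.valuation (y - W a)}
            add_mem' := by
              intro z z' hz hz'
              simp only [Set.mem_ofPred_eq, map_add, add_mul] at hz hz' ⊢
              exact (Valuation.map_add _ _ _).trans (max_le hz hz')
            zero_mem' := by simp
            smul_mem' := by
              intro r z hz
              simp only [Set.mem_ofPred_eq] at hz ⊢
              rw [Subring.smul_def, smul_eq_mul, map_mul (algebraMap L M), mul_assoc, map_mul]
              refine (mul_le_of_le_one_left' ?_).trans hz
              rw [ValuationSubring.valuation_le_one_iff, h.algebraMap_mem_iff]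
              exact r.2 }
        obtain ⟨z, hz⟩ := hA.exists_forall_sub_mem (fun a => a i j) N (by
          intro a a'
          have h1 : B.valuation (algebraMap L M (a i j - a' i j) * c j) ≤
              max (B.valuation (y - W a)) (B.valuation (y - W a')) := by
            refine (hWle (a - a') i j).trans ?_
            rw [← hWsub, ← sub_sub_sub_cancel_left _ _ y, max_comm]
            exact Valuation.map_sub _ _ _
          rcases le_max_iff.mp h1 with h1 | h1
          · exact Submodule.mem_sup_left h1
          · exact Submodule.mem_sup_right h1)
        exact ⟨z, hz⟩
      choose a₀ ha₀ using hex
      refine ⟨a₀, fun a => ?_⟩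
      have : B.valuation (W a₀ - W a) ≤ B.valuation (y - W a) := by
        rw [hWsub]
        exact hWge _ _ fun i j => ha₀ i j a
      rw [← sub_sub_sub_cancel_right y (W a₀) (W a)]
      exact (Valuation.map_sub _ _ _).trans (max_le le_rfl this)
    -- the best approximation `W a₀` can be improved
    set r := y - W a₀ with hr
    have hr0 : r ≠ 0 := fun h0 => hy a₀ (sub_eq_zero.mp h0).symm
    obtain ⟨l, hl, hlr⟩ := hcmem (Units.mk0 r hr0)
    set j := ((Units.mk0 r hr0 : Mˣ) : τ) with hj
    rw [Units.val_mk0, ← map_mul] at hlr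
    have hlc : algebraMap L M l * c j ≠ 0 := mul_ne_zero (by simpa using hl) (hc0 j)
    have hu1 : B.valuation (r / (algebraMap L M l * c j)) = 1 := by
      rw [map_div₀, hlr, div_self ((Valuation.ne_zero_iff _).mpr hlc)]
    let u : B := ⟨r / (algebraMap L M l * c j), (B.valuation_le_one_iff _).mp hu1.le⟩
    obtain ⟨α, hα⟩ : ∃ α : ι → A, ∀ i, IsLocalRing.residue A (α i) =
        bas.repr (IsLocalRing.residue B u) i :=
      ⟨fun i => (IsLocalRing.residue_surjective _).choose,
        fun i => (IsLocalRing.residue_surjective _).choose_spec⟩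
    have hlt : B.valuation ((u - ∑ i, ringMap A B h (α i) * b i : B) : M) < 1 := by
      refine valuation_lt_one_of_residue_eq_zero ?_
      rw [map_sub, sub_eq_zero, map_sum]
      simp_rw [map_mul, ← residueMap_residue, hα, hb]
      exact (bas.sum_repr _).symm
    let d : ι → τ → L := fun i j' => if j' = j then l * α i else 0
    have hd : W d = (algebraMap L M l * c j) * ((∑ i, ringMap A B h (α i) * b i : B) : M) := by
      simp only [W, d]
      rw [Finset.sum_eq_single j (fun j' _ hj' => by simp [hj']) (by simp)]
      push_cast
      rw [Finset.mul_sum, Finset.sum_mul]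
      refine Finset.sum_congr rfl fun i _ => ?_
      simp only [if_true, map_mul, coe_ringMap]
      ring
    have hlast : B.valuation (y - W (a₀ + d)) < B.valuation r := by
      have h1 : y - W (a₀ + d) =
          (algebraMap L M l * c j) * ((u - ∑ i, ringMap A B h (α i) * b i : B) : M) := by
        have h2 : W (a₀ + d) = W a₀ + W d := by
          rw [← sub_eq_iff_eq_add', hWsub, add_sub_cancel_left]
        rw [h2, ← sub_sub, ← hr, hd, AddSubgroupClass.coe_sub, mul_sub]
        congr 1
        exact (mul_div_cancel₀ _ hlc).symm
      rw [h1, map_mul, hlr]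
      exact mul_lt_of_lt_one_right (zero_lt_iff.mpr (by simpa using hlc)) hlt
    exact absurd (ha₀ (a₀ + d)) (not_le.mpr hlast)
  have htop : ⊤ ≤ Submodule.span L (Set.range fun x : ι × τ => (b x.1 : M) * c x.2) := by
    rintro y -
    obtain ⟨a, rfl⟩ := hspan y
    refine Submodule.sum_mem _ fun j _ => ?_
    rw [Finset.sum_mul]
    refine Submodule.sum_mem _ fun i _ => ?_
    rw [mul_assoc, ← Algebra.smul_def]
    exact Submodule.smul_mem _ _ (Submodule.subset_span ⟨(i, j), rfl⟩)
  rw [Module.finrank_eq_nat_card_basis (Module.Basis.mk hli htop), Nat.card_prod, mul_comm]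
  congr 1
  exact (Module.finrank_eq_nat_card_basis bas).symm

end Defectless

end SepTame

/-! ### Maximally complete fields are henselian -/

namespace SepTame

section Hensel

variable {L : Type u} [Field L] {A : ValuationSubring L}

/-- A strictly contracting map on a maximally complete field has a fixed point. A minimal ball among
the balls around `x` of radius `v (φ x - x)` exists by Zorn's lemma, and its centre is fixed. -/
theorem IsMaximallyComplete.exists_fixedPoint (hA : IsMaximallyComplete A) {S : Set L}
    (hne : S.Nonempty) {φ : L → L}
    (hS : ∀ x ∈ S, ∀ y, A.valuation (y - x) ≤ A.valuation (φ x - x) → y ∈ S)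
    (hφ : ∀ x ∈ S, ∀ y ∈ S, x ≠ y → A.valuation (φ x - φ y) < A.valuation (x - y)) :
    ∃ x ∈ S, φ x = x := by
  have hφ' : ∀ x ∈ S, ∀ y ∈ S, A.valuation (φ x - φ y) ≤ A.valuation (x - y) := by
    intro x hx y hy
    rcases eq_or_ne x y with rfl | hxy
    · simp
    · exact (hφ x hx y hy hxy).le
  let r : S → S → Prop := fun x y =>
    A.valuation ((y : L) - x) ≤ A.valuation (φ x - x)
  have hr : ∀ x y : S, r x y → A.valuation (φ y - y) ≤ A.valuation (φ x - x) := by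
    intro x y hxy
    have h1 : φ y - y = (φ y - φ x) + ((φ x - x) - (y - x)) := by ring
    rw [h1]
    refine (Valuation.map_add _ _ _).trans (max_le ((hφ' _ y.2 _ x.2).trans hxy) ?_)
    exact (Valuation.map_sub _ _ _).trans (max_le le_rfl hxy)
  have htrans : ∀ {x y z : S}, r x y → r y z → r x z := by
    intro x y z hxy hyz
    change A.valuation _ ≤ _
    rw [← sub_add_sub_cancel (z : L) y x]
    exact (Valuation.map_add _ _ _).trans (max_le (hyz.trans (hr x y hxy)) hxy)
  have hrefl : Std.Refl r := ⟨fun x => by change A.valuation ((x : L) - x) ≤ _; simp⟩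
  have hchain : ∀ C : Set S, IsChain r C → ∃ ub, ∀ x ∈ C, r x ub := by
    intro C hC
    rcases C.eq_empty_or_nonempty with rfl | ⟨x₀, hx₀⟩
    · exact ⟨⟨_, hne.some_mem⟩, by simp⟩
    let N : C → Submodule A L := fun x =>
      { carrier := {z | A.valuation z ≤ A.valuation (φ x - x)}
        add_mem' := by
          intro z z' hz hz'
          simp only [Set.mem_ofPred_eq] at hz hz' ⊢
          exact (Valuation.map_add _ _ _).trans (max_le hz hz')
        zero_mem' := by simp
        smul_mem' := by
          intro a z hz
          simp only [Set.mem_ofPred_eq] at hz ⊢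
          rw [Subring.smul_def, smul_eq_mul, map_mul]
          exact (mul_le_of_le_one_left' (A.valuation_le_one a)).trans hz }
    obtain ⟨y, hy⟩ := hA.exists_forall_sub_mem (fun x : C => ((x : S) : L)) N (by
      intro x y
      rcases hC.total x.2 y.2 with h | h
      · refine Submodule.mem_sup_left ?_
        exact (Valuation.map_sub_swap _ _ _).trans_le h
      · exact Submodule.mem_sup_right h)
    exact ⟨⟨y, hS x₀ x₀.2 y (hy ⟨x₀, hx₀⟩)⟩, fun x hx => hy ⟨x, hx⟩⟩
  obtain ⟨m, hm⟩ := exists_maximal_of_chains_bounded hchain htrans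
  refine ⟨m, m.2, ?_⟩
  by_contra hne
  have hmS : φ m ∈ S := hS m m.2 _ le_rfl
  have h1 : A.valuation ((m : L) - φ m) ≤ A.valuation (φ (φ m) - φ m) :=
    hm ⟨φ m, hmS⟩ (le_refl (A.valuation (φ m - m)))
  exact absurd (hφ _ hmS _ m.2 hne) (not_lt.mpr ((Valuation.map_sub_swap _ _ _).trans_le h1))

/-- Hensel's lemma: for a simple approximate root `a₀` of `f`, the Newton map
`x ↦ x - f x / f' a₀` is strictly contracting on the residue class of `a₀`. -/
theorem IsMaximallyComplete.henselianLocalRing (hA : IsMaximallyComplete A) :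
    HenselianLocalRing A where
  is_henselian := by
    intro f _ a₀ h₀ hu
    obtain ⟨u, hu⟩ := hu
    have key : ∀ x y : A, x - a₀ ∈ IsLocalRing.maximalIdeal A → y - a₀ ∈ IsLocalRing.maximalIdeal A →
        ∃ e ∈ IsLocalRing.maximalIdeal A,
          (x - ↑u⁻¹ * f.eval x) - (y - ↑u⁻¹ * f.eval y) = (x - y) * e := by
      intro x y hx hy
      obtain ⟨k, hk⟩ := f.binomExpansion y (x - y)
      rw [add_sub_cancel] at hk
      obtain ⟨d, hd⟩ := f.derivative.sub_dvd_eval_sub y a₀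
      have hxy : x - y ∈ IsLocalRing.maximalIdeal A := by
        simpa using Ideal.sub_mem _ hx hy
      refine ⟨-(↑u⁻¹ * ((y - a₀) * d + (x - y) * k)), ?_, ?_⟩
      · refine neg_mem (Ideal.mul_mem_left _ _ (Ideal.add_mem _ ?_ ?_))
        · exact Ideal.mul_mem_right _ _ hy
        · exact Ideal.mul_mem_right _ _ hxy
      · have h1 : (↑u⁻¹ : A) * f.derivative.eval a₀ = 1 := by rw [← hu, Units.inv_mul]
        rw [← hd, hk]
        linear_combination (-(x - y)) * h1
    classical
    let φ : L → L := fun x => if hx : x ∈ A then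
      ((⟨x, hx⟩ - ↑u⁻¹ * f.eval ⟨x, hx⟩ : A) : L) else x
    have hφ : ∀ x : A, φ x = ((x - ↑u⁻¹ * f.eval x : A) : L) := fun x => by simp [φ]
    let S : Set L := {x | ∃ a : A, a - a₀ ∈ IsLocalRing.maximalIdeal A ∧ (a : L) = x}
    obtain ⟨_, ⟨x, hx, rfl⟩, hfix⟩ := hA.exists_fixedPoint (S := S) (φ := φ)
      ⟨a₀, a₀, by simp, rfl⟩ (by
        rintro _ ⟨x, hx, rfl⟩ y hy
        have hfx : f.eval x ∈ IsLocalRing.maximalIdeal A := by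
          obtain ⟨d, hd⟩ := f.sub_dvd_eval_sub x a₀
          rw [← sub_add_cancel (f.eval x) (f.eval a₀), hd]
          exact Ideal.add_mem _ (Ideal.mul_mem_right _ _ hx) h₀
        have hlt : A.valuation (y - x) < 1 := by
          refine hy.trans_lt ?_
          rw [hφ, ← AddSubgroupClass.coe_sub, ← ValuationSubring.valuation_lt_one_iff,
            sub_sub_cancel_left]
          exact neg_mem (Ideal.mul_mem_left _ _ hfx)
        have hmem : y - x ∈ A := (A.valuation_le_one_iff _).mp hlt.le
        refine ⟨⟨y - x, hmem⟩ + x, ?_, by simp⟩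
        rw [add_sub_assoc]
        exact Ideal.add_mem _ ((A.valuation_lt_one_iff _).mpr hlt) hx) (by
        rintro _ ⟨x, hx, rfl⟩ _ ⟨y, hy, rfl⟩ hxy
        obtain ⟨e, he, hxye⟩ := key x y hx hy
        rw [hφ, hφ, ← AddSubgroupClass.coe_sub, hxye, ← AddSubgroupClass.coe_sub]
        push_cast
        rw [map_mul]
        refine mul_lt_of_lt_one_right (zero_lt_iff.mpr ?_) ((A.valuation_lt_one_iff _).mp he)
        simpa [sub_eq_zero] using hxy)
    refine ⟨x, ?_, hx⟩
    rw [hφ] at hfix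
    have h1 : x - ↑u⁻¹ * f.eval x = x := Subtype.ext hfix
    rw [sub_eq_self] at h1
    exact (Units.mul_right_eq_zero _).mp h1

end Hensel

end SepTame

/-! ### Hahn series fields: Frobenius and maximal completeness -/

namespace SepTame

section AddValuation

variable {K : Type u} [Field K] {Γ : Type w} [AddCommGroup Γ] [LinearOrder Γ]
  [IsOrderedAddMonoid Γ] (v : AddValuation K (WithTop Γ))

theorem mem_valuationRing_iff {x : K} : x ∈ valuationRing v ↔ 0 ≤ v x := Iff.rfl

theorem valuation_valuationRing_le_iff {x y : K} :
    (valuationRing v).valuation x ≤ (valuationRing v).valuation y ↔ v y ≤ v x := by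
  rcases eq_or_ne y 0 with rfl | hy
  · simp [AddValuation.top_iff]
  have hy' : v y ≠ ⊤ := by rwa [Ne, AddValuation.top_iff]
  have h1 : 0 < (valuationRing v).valuation y := zero_lt_iff.mpr (by simpa using hy)
  rw [← div_le_one₀ h1, ← map_div₀, ValuationSubring.valuation_le_one_iff, mem_valuationRing_iff]
  conv_rhs => rw [← div_mul_cancel₀ x hy, AddValuation.map_mul]
  simpa using (WithTop.add_le_add_iff_right (x := 0) (y := v (x / y)) hy').symm

theorem valuation_valuationRing_lt_iff {x y : K} :
    (valuationRing v).valuation x < (valuationRing v).valuation y ↔ v y < v x := by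
  rw [← not_le, valuation_valuationRing_le_iff, not_le]

end AddValuation

section HahnSeries

open scoped Pointwise
open HahnSeries

variable {k : Type u} [Field k] {Γ : Type v} [AddCommGroup Γ] [LinearOrder Γ]
  [IsOrderedAddMonoid Γ]

theorem exists_isPWO_support_pow_subset {S : Set Γ} (hS : S.IsPWO) (n : ℕ) :
    ∃ T : Set Γ, T.IsPWO ∧ ∀ z : HahnSeries Γ k, z.support ⊆ S → (z ^ n).support ⊆ T := by
  induction n with
  | zero => exact ⟨{0}, Set.isPWO_singleton 0, fun z _ => by simp⟩
  | succ n ih =>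
    obtain ⟨T, hT, hTz⟩ := ih
    refine ⟨T + S, hT.add hS, fun z hz => ?_⟩
    rw [pow_succ]
    exact support_mul_subset.trans (Set.add_subset_add (hTz z hz) hz)

/-- A coefficient of the `n`-th power of a series with support in a given well-ordered set depends
on finitely many coefficients only. -/
theorem exists_finset_coeff_pow_eq_zero {S : Set Γ} (hS : S.IsPWO) {n : ℕ} (hn : n ≠ 0) (γ : Γ) :
    ∃ F : Finset Γ, ∀ z : HahnSeries Γ k, z.support ⊆ S → (∀ i ∈ F, z.coeff i = 0) →
      (z ^ n).coeff γ = 0 := by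
  classical
  obtain ⟨m, rfl⟩ := Nat.exists_eq_succ_of_ne_zero hn
  obtain ⟨T, hT, hTz⟩ := exists_isPWO_support_pow_subset (k := k) hS m
  refine ⟨(Finset.antidiagonal hT hS γ).image Prod.snd, fun z hz h0 => ?_⟩
  by_contra hne
  rw [pow_succ] at hne
  obtain ⟨i, hi, j, hj, hij⟩ := support_mul_subset (mem_support _ _ |>.mpr hne)
  refine hj (h0 j (Finset.mem_image.mpr ⟨(i, j), ?_, rfl⟩))
  exact Finset.mem_antidiagonal.mpr ⟨hTz z hz hi, hz hj, hij⟩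

variable (p : ℕ) [Fact p.Prime] [CharP k p]

instance charP_hahnSeries : CharP (HahnSeries Γ k) p :=
  charP_of_injective_ringHom (HahnSeries.C_injective (Γ := Γ) (R := k)) p

/-- The Frobenius of a Hahn series field acts on coefficients and exponents. -/
theorem coeff_pow_char (x : HahnSeries Γ k) (γ : Γ) :
    (x ^ p).coeff (p • γ) = x.coeff γ ^ p := by
  classical
  have hp : p ≠ 0 := (Fact.out : p.Prime).ne_zero
  obtain ⟨F, hF⟩ := exists_finset_coeff_pow_eq_zero (k := k) x.isPWO_support hp (p • γ)
  set u : HahnSeries Γ k := ∑ i ∈ insert γ F, single i (x.coeff i) with hu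
  have hucoeff : ∀ j, u.coeff j = if j ∈ insert γ F then x.coeff j else 0 := by
    intro j
    rw [hu, coeff_sum]
    split_ifs with hj
    · rw [Finset.sum_eq_single_of_mem j hj fun i _ hij => coeff_single_of_ne hij.symm,
        coeff_single_same]
    · exact Finset.sum_eq_zero fun i hi => coeff_single_of_ne fun h => hj (h ▸ hi)
  have hz : ((x - u) ^ p).coeff (p • γ) = 0 := by
    refine hF _ ?_ ?_
    · intro j hj hxj
      refine hj ?_
      rw [coeff_sub, hucoeff, hxj]
      simp
    · intro i hi
      rw [coeff_sub, hucoeff, if_pos (Finset.mem_insert_of_mem hi), sub_self]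
  have hx : x ^ p = u ^ p + (x - u) ^ p := by rw [← add_pow_char, add_sub_cancel]
  rw [hx, coeff_add, hz, add_zero, hu, sum_pow_char, coeff_sum]
  simp_rw [single_pow]
  rw [Finset.sum_eq_single γ]
  · simp
  · intro i _ hi
    exact coeff_single_of_ne fun h => hi (nsmul_right_injective hp h).symm
  · simp

theorem coeff_pow_char_pow (x : HahnSeries Γ k) (γ : Γ) (n : ℕ) :
    (x ^ p ^ n).coeff (p ^ n • γ) = x.coeff γ ^ p ^ n := by
  induction n with
  | zero => simp
  | succ n ih => rw [pow_succ, pow_mul, mul_comm (p ^ n) p, mul_smul, coeff_pow_char, ih,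
      ← pow_mul, mul_comm]

theorem perfectRing_hahnSeries [PerfectField k] (hΓ : ∀ γ : Γ, ∃ δ : Γ, p • δ = γ) :
    PerfectRing (HahnSeries Γ k) p := by
  have := PerfectField.toPerfectRing (K := k) p
  have hp : p ≠ 0 := (Fact.out : p.Prime).ne_zero
  refine PerfectRing.ofSurjective _ _ fun x => ?_
  let y : HahnSeries Γ k :=
    { coeff := fun γ => (frobeniusEquiv k p).symm (x.coeff (p • γ))
      isPWO_support' := by
        rw [Set.isPWO_iff_isWF, Set.isWF_iff_no_descending_seq]
        intro f hf hmem
        refine Set.isWF_iff_no_descending_seq.mp x.isWF_support (fun n => p • f n)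
          (fun m n hmn => nsmul_right_strictMono hp (hf hmn)) fun n => ?_
        have := hmem n
        simpa using this }
  refine ⟨y, ?_⟩
  ext γ
  obtain ⟨δ, rfl⟩ := hΓ γ
  rw [frobenius_def, coeff_pow_char]
  exact frobeniusEquiv_symm_pow_p k p _

variable (k Γ) in
theorem isMaximallyComplete_hahnSeries :
    IsMaximallyComplete (valuationRing (addVal Γ k)) := by
  classical
  -- a submodule `N` is determined by the exponents `δ` for which it does not contain `t ^ δ`
  have hmono : ∀ (N : Submodule (valuationRing (addVal Γ k)) (HahnSeries Γ k)) {δ δ' : Γ},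
      δ ≤ δ' → single δ 1 ∈ N → single δ' 1 ∈ N := by
    intro N δ δ' hδ hN
    have hmem : (single (δ' - δ) (1 : k)) ∈ valuationRing (addVal Γ k) := by
      change 0 ≤ addVal Γ k _
      rw [addVal_apply, orderTop_single one_ne_zero]
      exact_mod_cast sub_nonneg.mpr hδ
    have := N.smul_mem ⟨_, hmem⟩ hN
    rw [Subring.smul_def, smul_eq_mul] at this
    simpa using this
  have hmem : ∀ (N : Submodule (valuationRing (addVal Γ k)) (HahnSeries Γ k))
      (z : HahnSeries Γ k), z ∈ N ↔ ∀ δ : Γ, single δ 1 ∉ N → z.coeff δ = 0 := by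
    intro N z
    have key : z ≠ 0 → (z ∈ N ↔ single z.order 1 ∈ N) := by
      intro hz
      have aux : ∀ y z : HahnSeries Γ k, addVal Γ k y ≤ addVal Γ k z → y ∈ N → z ∈ N := by
        intro y z hyz hyN
        obtain ⟨a, rfl⟩ := (ValuationSubring.valuation_le_iff _ _ _).mp
          ((valuation_valuationRing_le_iff _).mpr hyz)
        exact N.smul_mem a hyN
      have hv : addVal Γ k z = addVal Γ k (single z.order 1) := by
        rw [addVal_apply_of_ne hz, addVal_apply, orderTop_single one_ne_zero]
      exact ⟨aux _ _ hv.le, aux _ _ hv.ge⟩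
    constructor
    · intro hz δ hδ
      by_contra hne
      have hz0 : z ≠ 0 := ne_zero_of_coeff_ne_zero hne
      exact hδ (hmono N (order_le_of_coeff_ne_zero hne) ((key hz0).mp hz))
    · intro h
      rcases eq_or_ne z 0 with rfl | hz
      · exact N.zero_mem
      · rw [key hz]
        by_contra hN
        exact (coeff_order_eq_zero.not.mpr hz) (h _ hN)
  intro C hC
  let f : Γ → k := fun δ =>
    if h : ∃ c ∈ C, single δ 1 ∉ c.2 then h.choose.1.coeff δ else 0
  have hf : ∀ c ∈ C, ∀ δ, single δ 1 ∉ c.2 → f δ = c.1.coeff δ := by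
    intro c hc δ hδ
    have h : ∃ c ∈ C, single δ 1 ∉ c.2 := ⟨c, hc, hδ⟩
    simp only [f, dif_pos h]
    obtain ⟨n, hn, n', hn', hnn⟩ :=
      Submodule.mem_sup.mp (hC _ h.choose_spec.1 c hc)
    rw [← sub_eq_zero, ← coeff_sub, ← hnn, coeff_add, (hmem _ _).mp hn δ h.choose_spec.2,
      (hmem _ _).mp hn' δ hδ, add_zero]
  let y : HahnSeries Γ k :=
    { coeff := f
      isPWO_support' := by
        rw [Set.isPWO_iff_isWF, Set.isWF_iff_no_descending_seq]
        intro g hg hsupp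
        have h0 : ∃ c ∈ C, single (g 0) 1 ∉ c.2 := by
          by_contra hne
          exact hsupp 0 (dif_neg hne)
        obtain ⟨c, hc, hcδ⟩ := h0
        refine Set.isWF_iff_no_descending_seq.mp c.1.isWF_support g hg fun n => ?_
        rw [mem_support, ← hf c hc (g n) fun h => hcδ (hmono _ (hg.antitone (zero_le)) h)]
        exact hsupp n }
  refine ⟨y, fun c hc => (hmem _ _).mpr fun δ hδ => ?_⟩
  rw [coeff_sub, sub_eq_zero]
  exact hf c hc δ hδ

end HahnSeries

end SepTame

/-! ### Leading terms attained on the purely inseparable subfield -/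

namespace SepTame

section Approximation

open HahnSeries
open Polynomial (X aeval derivative)
open scoped Polynomial

theorem coe_lt_orderTop_iff {k : Type u} [Zero k] {Γ : Type v} [LinearOrder Γ]
    {z : HahnSeries Γ k} {γ : Γ} :
    (γ : WithTop Γ) < z.orderTop ↔ ∀ δ ≤ γ, z.coeff δ = 0 := by
  constructor
  · exact fun h δ hδ => coeff_eq_zero_of_lt_orderTop ((WithTop.coe_le_coe.mpr hδ).trans_lt h)
  · intro h
    by_contra hlt
    push Not at hlt
    obtain ⟨δ, hδ⟩ := WithTop.ne_top_iff_exists.mp (ne_top_of_le_ne_top WithTop.coe_ne_top hlt)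
    exact coeff_orderTop_ne hδ.symm (h δ (WithTop.coe_le_coe.mp (hδ.trans_le hlt)))

variable {k : Type u} [Field k] {Γ : Type v} [AddCommGroup Γ] [LinearOrder Γ]
  [IsOrderedAddMonoid Γ] {p : ℕ} [Fact p.Prime] [CharP k p]

/-- Artin--Schreier equations `w ^ q - w = c t ^ γ` with `γ < 0` are solved by the series
`∑ j ≥ 1, (c t ^ γ) ^ (1 / q ^ j)`. -/
theorem exists_pow_sub_self_eq_single [PerfectField k] (hΓ : ∀ γ : Γ, ∃ δ : Γ, p • δ = γ)
    {n : ℕ} (hn : n ≠ 0) {γ : Γ} (hγ : γ < 0) (c : k) :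
    ∃ w : HahnSeries Γ k, w ^ p ^ n - w = single γ c ∧ (γ : WithTop Γ) < w.orderTop := by
  have := PerfectField.toPerfectRing (K := k) p
  have hp1 : 1 < p := (Fact.out : p.Prime).one_lt
  have hq1 : 1 < p ^ n := Nat.one_lt_pow hn hp1
  have hdiv : ∀ m (γ : Γ), ∃ δ : Γ, p ^ m • δ = γ := by
    intro m
    induction m with
    | zero => exact fun γ => ⟨γ, by simp⟩
    | succ m ih =>
      intro γ
      obtain ⟨δ, rfl⟩ := ih γ
      obtain ⟨ε, rfl⟩ := hΓ δ
      exact ⟨ε, by rw [pow_succ, mul_smul]⟩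
  choose r hr using hdiv n
  have hroot : ∀ c : k, ∃ d : k, d ^ p ^ n = c :=
    (bijective_iterateFrobenius k p (n := n)).surjective
  choose s hs using hroot
  have hneg : ∀ β, β < 0 → r β < 0 ∧ β < r β := by
    intro β hβ
    have h1 : r β < 0 := by
      by_contra h
      push Not at h
      exact absurd (hr β ▸ nsmul_nonneg h (p ^ n)) (not_le.mpr hβ)
    refine ⟨h1, ?_⟩
    conv_lhs => rw [← hr β]
    obtain ⟨m, hm⟩ := Nat.exists_eq_add_of_lt hq1
    rw [hm, show 1 + m + 1 = (m + 1) + 1 by ring, succ_nsmul]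
    exact add_lt_of_neg_left _ (nsmul_neg h1 (Nat.succ_ne_zero m))
  let e : ℕ → Γ := fun j => r^[j + 1] γ
  let a : ℕ → k := fun j => s^[j + 1] c
  have he0 : ∀ j, r^[j] γ < 0 := by
    intro j
    induction j with
    | zero => exact hγ
    | succ j ih => rw [Function.iterate_succ_apply']; exact (hneg _ ih).1
  have hmono : StrictMono e := strictMono_nat_of_lt_succ fun j => by
    change r^[j + 1] γ < r^[j + 1 + 1] γ
    rw [Function.iterate_succ_apply' r (j + 1)]
    exact (hneg _ (he0 _)).2
  have he : ∀ j, p ^ n • e (j + 1) = e j := fun j => by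
    simp only [e]
    rw [Function.iterate_succ_apply' r (j + 1), hr]
  have ha : ∀ j, a (j + 1) ^ p ^ n = a j := fun j => by
    simp only [a]
    rw [Function.iterate_succ_apply' s (j + 1), hs]
  let x : HahnSeries ℕ k := ⟨a, Set.isPWO_of_wellQuasiOrderedLE _⟩
  let w : HahnSeries Γ k := embDomain (OrderEmbedding.ofStrictMono e hmono) x
  have hw : ∀ j, w.coeff (e j) = a j := fun j =>
    embDomain_coeff (f := OrderEmbedding.ofStrictMono e hmono) (x := x) (a := j)
  have hw' : ∀ β, (∀ j, e j ≠ β) → w.coeff β = 0 := fun β hβ =>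
    embDomain_of_notMem_range (by rintro ⟨j, hj⟩; exact hβ j hj)
  have hlt : ∀ j, γ < e j := fun j =>
    (hneg γ hγ).2.trans_le (hmono.monotone (Nat.zero_le j))
  have hinj := nsmul_right_injective (M := Γ) (by omega : p ^ n ≠ 0)
  refine ⟨w, ?_, coe_lt_orderTop_iff.mpr fun δ hδ => hw' δ fun j hj => ?_⟩
  · ext β
    obtain ⟨β, rfl⟩ := hdiv n β
    rw [coeff_sub, coeff_pow_char_pow]
    by_cases hβ : ∃ j, e j = β
    · obtain ⟨j, rfl⟩ := hβ
      rw [hw]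
      rcases j with _ | j
      · have h0 : p ^ n • e 0 = γ := hr γ
        rw [h0, hw' γ fun j => (hlt j).ne', coeff_single_same, sub_zero]
        exact hs c
      · rw [he, ha, hw, sub_self, coeff_single_of_ne (hlt j).ne']
    · push Not at hβ
      have h1 : ∀ j, e j ≠ p ^ n • β := by
        intro j hj
        rw [← he j] at hj
        exact hβ _ (hinj hj)
      rw [hw' β hβ, hw' _ h1, coeff_single_of_ne, sub_zero, zero_pow (by omega)]
      intro h
      refine hβ 0 (hinj ?_)
      exact (hr γ).trans h.symm
  · exact absurd (hj ▸ hlt j) (not_lt.mpr hδ)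

/-- A subfield of a purely inseparable extension contains the simple roots of its polynomials. -/
theorem mem_range_algebraMap_of_simple_root {K L : Type*} [Field K] [Field L] [Algebra K L]
    [IsPurelyInseparable K L] {f : K[X]} {x : L} (hx : aeval x f = 0)
    (hx' : aeval x (derivative f) ≠ 0) : x ∈ (algebraMap K L).range := by
  refine IsPurelyInseparable.inseparable K x ?_
  obtain ⟨g, hg⟩ := minpoly.dvd K x hx
  refine (Polynomial.separable_iff_derivative_ne_zero
    (minpoly.irreducible (IsPurelyInseparable.isIntegral' K x))).mpr fun h0 => hx' ?_
  rw [hg, Polynomial.derivative_mul, h0, map_add, map_mul, map_mul, minpoly.aeval, map_zero,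
    zero_mul, zero_mul, add_zero]

/-- A subfield `K` of a Hahn series field `L`, with `L / K` purely inseparable, contains elements
with any given leading term. With `m` the leading monomial, some
power `m ^ q` lies in `K`, and for a monomial `d ∈ K` of large value the separable equation
`X ^ q - d ^ (q - 1) X = m ^ q` has a root `m + d w` close to `m`. -/
theorem exists_lt_orderTop_algebraMap_sub [PerfectField k] [Nontrivial Γ]
    (hΓ : ∀ γ : Γ, ∃ δ : Γ, p • δ = γ)
    {K : Type*} [Field K] [Algebra K (HahnSeries Γ k)] [IsPurelyInseparable K (HahnSeries Γ k)]
    {l : HahnSeries Γ k} (hl : l ≠ 0) :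
    ∃ x : K, l.orderTop < (algebraMap K (HahnSeries Γ k) x - l).orderTop := by
  have hchK : CharP K p := (RingHom.charP_iff (algebraMap K (HahnSeries Γ k))
    (algebraMap K (HahnSeries Γ k)).injective p).mpr inferInstance
  have hp := (Fact.out : p.Prime)
  set γ := l.order with hγ
  set m : HahnSeries Γ k := single γ (l.coeff γ) with hm
  obtain ⟨δ, hδγ, d, hd⟩ : ∃ δ : Γ, γ < δ ∧ ∃ d : K, algebraMap K _ d = single δ (1 : k) := by
    obtain ⟨ε, hε⟩ := exists_zero_lt (α := Γ)
    obtain ⟨n, d, hd⟩ := IsPurelyInseparable.pow_mem K p (single (|γ| + ε) (1 : k))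
    refine ⟨p ^ n • (|γ| + ε), ?_, d, by rw [hd, single_pow, one_pow]⟩
    have h1 : 0 ≤ |γ| + ε := add_nonneg (abs_nonneg _) hε.le
    calc γ ≤ |γ| := le_abs_self γ
      _ < |γ| + ε := lt_add_of_pos_right _ hε
      _ = 1 • (|γ| + ε) := (one_nsmul _).symm
      _ ≤ p ^ n • (|γ| + ε) := nsmul_le_nsmul_left h1 (Nat.one_le_pow _ _ hp.pos)
  obtain ⟨n, a, ha⟩ : ∃ (n : ℕ) (a : K), algebraMap K _ a = m ^ p ^ (n + 1) := by
    obtain ⟨n, a, ha⟩ := IsPurelyInseparable.pow_mem K p m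
    exact ⟨n, a ^ p, by rw [map_pow, ha, pow_succ, pow_mul]⟩
  obtain ⟨w, hw, hwo⟩ := exists_pow_sub_self_eq_single hΓ (Nat.succ_ne_zero n)
    (sub_neg.mpr hδγ) (l.coeff γ)
  set q := p ^ (n + 1) with hq
  have hq1 : q = q - 1 + 1 := (Nat.sub_add_cancel (Nat.one_le_pow _ _ hp.pos)).symm
  have hdm : single δ (1 : k) * single (γ - δ) (l.coeff γ) = m := by
    rw [single_mul_single, one_mul, add_sub_cancel]
  set D : HahnSeries Γ k := single δ (1 : k) with hD
  have hD0 : D ≠ 0 := single_ne_zero one_ne_zero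
  have hroot : (m + D * w) ^ q - D ^ (q - 1) * (m + D * w) - m ^ q = 0 := by
    rw [hq, add_pow_char_pow, mul_pow, ← hq, ← sub_eq_iff_eq_add.mp hw |>.symm, ← hdm]
    nth_rewrite 2 [hq1]
    rw [pow_succ D]
    ring
  obtain ⟨x, hx⟩ := mem_range_algebraMap_of_simple_root (K := K) (x := m + D * w)
    (f := X ^ q - Polynomial.C (d ^ (q - 1)) * X - Polynomial.C a) (by simpa [hd, ha] using hroot) (by
      have : ((q : ℕ) : K[X]) = 0 := by rw [hq, Nat.cast_pow, CharP.cast_eq_zero, zero_pow (by simp)]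
      have hder : derivative (X ^ q - Polynomial.C (d ^ (q - 1)) * X - Polynomial.C a) =
          -Polynomial.C (d ^ (q - 1)) := by
        rw [Polynomial.derivative_sub, Polynomial.derivative_sub, Polynomial.derivative_C,
          Polynomial.derivative_C_mul, Polynomial.derivative_X, Polynomial.derivative_X_pow]
        simp [-map_pow, this]
      rw [hder, map_neg, Polynomial.aeval_C, map_pow, hd]
      exact neg_ne_zero.mpr (pow_ne_zero _ hD0))
  refine ⟨x, ?_⟩
  rw [hx, ← order_eq_orderTop_of_ne_zero hl, ← hγ, coe_lt_orderTop_iff]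
  intro β hβ
  rw [coeff_sub, coeff_add]
  have h1 : (D * w).coeff β = 0 := by
    rw [hD, coeff_single_mul, one_mul]
    exact coe_lt_orderTop_iff.mp hwo _ (sub_le_sub_right hβ δ)
  rw [h1, add_zero, sub_eq_zero]
  rcases hβ.lt_or_eq with hβ | rfl
  · rw [hm, coeff_single_of_ne hβ.ne, coeff_eq_zero_of_lt_order hβ]
  · rw [hm, coeff_single_same]

end Approximation

end SepTame

/-! ### Subfields of given imperfection degree -/

namespace SepTame

section Imperfection

open IntermediateField Polynomial

theorem notMem_adjoin_pow_of_transcendental {Q L : Type*} [Field Q] [Field L] [Algebra Q L] {n : ℕ}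
    (hn : 1 < n) {x : L} (hx : Transcendental Q x) : x ∉ Q⟮x ^ n⟯ := by
  intro hmem
  obtain ⟨r, s, hrs⟩ := (mem_adjoin_simple_iff Q x).mp hmem
  have hx0 : x ≠ 0 := by
    rintro rfl
    exact hx isAlgebraic_zero
  have hs : aeval (x ^ n) s ≠ 0 := by
    intro h0
    rw [h0, div_zero] at hrs
    exact hx0 hrs
  rw [eq_div_iff hs, ← expand_aeval, ← expand_aeval] at hrs
  have h1 : X * expand Q n s = expand Q n r := by
    rw [← sub_eq_zero]
    by_contra hne
    exact hx ⟨_, hne, by rw [map_sub, map_mul, aeval_X, hrs, sub_self]⟩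
  have hs0 : expand Q n s ≠ 0 := by
    rw [Ne, expand_eq_zero (by omega)]
    rintro rfl
    simp at hs
  have h2 := congrArg natDegree h1
  rw [natDegree_X_mul hs0, natDegree_expand, natDegree_expand] at h2
  have h3 := congrArg (· % n) h2
  simp only [Nat.mul_add_mod_self_right, Nat.mul_mod_left] at h3
  rw [Nat.mod_eq_of_lt hn] at h3
  omega

variable {p : ℕ} [Fact p.Prime]

theorem isSeparable_pow_char {E Q L : Type*} [Field E] [Field Q] [Field L] [Algebra E L]
    [Algebra Q L] [CharP L p] {M : IntermediateField Q L}
    (hEM : ∀ e : E, algebraMap E L e ^ p ∈ M) {z : L} (hz : IsSeparable E z) :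
    IsSeparable M (z ^ p) := by
  let φ : E →+* M := ((frobenius L p).comp (algebraMap E L)).codRestrict M hEM
  have hφ : (algebraMap M L).comp φ = (frobenius L p).comp (algebraMap E L) := rfl
  have hsep : ((minpoly E z).map φ).Separable := Separable.map hz
  refine hsep.of_dvd (minpoly.dvd M _ ?_)
  rw [aeval_def, eval₂_map, hφ, ← frobenius_def, ← hom_eval₂, ← aeval_def, minpoly.aeval, map_zero]

theorem mem_range_algebraMap_of_isSeparable_of_pow_mem {F L : Type*} [Field F] [Field L]
    [Algebra F L] [CharP L p] {a : L} (ha : IsSeparable F a)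
    (hp : a ^ p ∈ (algebraMap F L).range) : a ∈ (algebraMap F L).range := by
  have hch : CharP F p := (RingHom.charP_iff (algebraMap F L) (algebraMap F L).injective p).mpr
    inferInstance
  have h1 := adjoin_simple_eq_adjoin_pow_expChar_of_isSeparable F L ha p
  rw [adjoin_simple_eq_bot_iff.mpr (mem_bot.mpr hp), adjoin_simple_eq_bot_iff] at h1
  exact mem_bot.mp h1

/-- If `M` contains `E ^ p`, the `p`-th powers of the separable closure of `E` are separable
over `M`. So an element of the separable closure which is generated by those `p`-th powers and by
elements of `M` lies in `M` as soon as its `p`-th power does. -/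
theorem mem_of_mem_pSpan_separableClosure {E Q L : Type*} [Field E] [Field Q] [Field L]
    [Algebra E L] [Algebra Q L] [CharP L p] {M : IntermediateField Q L}
    (hEM : ∀ e : E, algebraMap E L e ^ p ∈ M) {S : Set (separableClosure E L)}
    (hS : ∀ s ∈ S, (s : L) ∈ M) {a : separableClosure E L} (hap : (a : L) ^ p ∈ M)
    (ha : a ∈ pSpan p S) : (a : L) ∈ M := by
  have hsub : pSpan p S ≤ (separableClosure M L).toSubfield.comap
      (algebraMap (separableClosure E L) L) := by
    refine Subfield.closure_le.mpr ?_
    rintro _ (⟨z, rfl⟩ | hs)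
    · change algebraMap (separableClosure E L) L (z ^ p) ∈ separableClosure M L
      rw [map_pow, mem_separableClosure_iff]
      exact isSeparable_pow_char (E := E) hEM (mem_separableClosure_iff.mp z.2)
    · exact (separableClosure M L).algebraMap_mem (⟨_, hS _ hs⟩ : M)
  have hsep : IsSeparable M (a : L) := mem_separableClosure_iff.mp (hsub ha)
  obtain ⟨m, hm⟩ := mem_range_algebraMap_of_isSeparable_of_pow_mem hsep ⟨⟨_, hap⟩, rfl⟩
  exact hm ▸ m.2

/-- Algebraically independent elements `x` over a perfect subfield `P` of `L` form a `p`-basis of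
the relative separable closure `K` of `P(x)` in `L`: the extension `K / K ^ p (x)` is both
separable and purely inseparable, and if `x i` was redundant it would lie in
`P (x j | j ≠ i) (x i ^ p)`. -/
theorem hasElementaryImperfectionDegree_separableClosure {P : Type*} {L : Type u} [Field P]
    [Field L] [Algebra P L] [CharP L p] (hP : ∀ a : P, ∃ b, b ^ p = a) {ι : Type*} {x : ι → L}
    (hx : AlgebraicIndependent P x) :
    HasElementaryImperfectionDegree
      (separableClosure (adjoin P (Set.range x)) L) p (ENat.card ι) := by
  have hp := (Fact.out : p.Prime)
  set E := adjoin P (Set.range x) with hE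
  set K := separableClosure E L with hK
  have hchK : CharP K p := (RingHom.charP_iff (algebraMap K L) (algebraMap K L).injective p).mpr
    inferInstance
  have hEK : ∀ e ∈ E, e ∈ K := fun e he => K.algebraMap_mem (⟨e, he⟩ : E)
  have hPE : ∀ a : P, algebraMap P L a ∈ E := E.algebraMap_mem
  have hxE : ∀ i, x i ∈ E := fun i => subset_adjoin _ _ ⟨i, rfl⟩
  have hEclos : ∀ F : Subfield L, (∀ a : P, algebraMap P L a ∈ F) → (∀ i, x i ∈ F) →
      ∀ e ∈ E, e ∈ F := by
    intro F hPF hxF e he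
    have h1 : e ∈ E.toSubfield := he
    rw [hE, adjoin_toSubfield] at h1
    refine Subfield.closure_le.mpr ?_ h1
    rintro _ (⟨a, rfl⟩ | ⟨i, rfl⟩)
    · exact hPF a
    · exact hxF i
  let y : ι → K := fun i => ⟨x i, hEK _ (hxE i)⟩
  have hyinj : Function.Injective y := fun i j hij =>
    hx.injective (congrArg Subtype.val hij)
  refine ⟨Set.range y, ⟨?_, ?_⟩, ?_⟩
  · rintro _ ⟨i, rfl⟩ hmem
    have htr : Transcendental (adjoin P (x '' {i}ᶜ)) (x i) :=
      transcendental_adjoin_iff.mpr (hx.transcendental_adjoin (s := {i}ᶜ) (by simp))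
    set Q := adjoin P (x '' {i}ᶜ) with hQ
    have hPQ : ∀ a : P, algebraMap P L a ∈ Q := Q.algebraMap_mem
    set M := adjoin Q {x i ^ p} with hM
    have hQM : ∀ q ∈ Q, q ∈ M := fun q hq => M.algebraMap_mem (⟨q, hq⟩ : Q)
    have hxM : ∀ j, j ≠ i → x j ∈ M := fun j hj => hQM _ (subset_adjoin _ _ ⟨j, hj, rfl⟩)
    have hxpM : x i ^ p ∈ M := subset_adjoin _ _ rfl
    have hEM : ∀ e ∈ E, e ^ p ∈ M := by
      refine hEclos (M.toSubfield.comap (frobenius L p)) (fun a => ?_) (fun j => ?_)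
      · change algebraMap P L a ^ p ∈ M
        exact pow_mem (hQM _ (hPQ a)) p
      · change x j ^ p ∈ M
        by_cases hj : j = i
        · rw [hj]; exact hxpM
        · exact pow_mem (hxM j hj) p
    refine notMem_adjoin_pow_of_transcendental hp.one_lt htr
      (mem_of_mem_pSpan_separableClosure (fun e => hEM _ e.2) ?_ hxpM hmem)
    rintro _ ⟨⟨j, rfl⟩, hj⟩
    exact hxM j fun h => hj (by rw [h]; rfl)
  · set N := pSpan p (Set.range y) with hN
    have hpow : ∀ z : K, z ^ p ∈ N := fun z => Subfield.subset_closure (Or.inl ⟨z, rfl⟩)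
    have hEN : ∀ e : E, algebraMap E K e ∈ N := by
      intro e
      obtain ⟨z, hz, hze⟩ := hEclos (N.map (algebraMap K L)) (fun a => by
        obtain ⟨b, rfl⟩ := hP a
        exact ⟨_, hpow ⟨_, hEK _ (hPE b)⟩, by rw [map_pow, map_pow]; rfl⟩)
        (fun i => ⟨y i, Subfield.subset_closure (Or.inr ⟨i, rfl⟩), rfl⟩) e e.2
      have : algebraMap E K e = z := Subtype.ext hze.symm
      rw [this]; exact hz
    let _ : Algebra E N := ((algebraMap E K).codRestrict N hEN).toAlgebra
    have : IsScalarTower E N K := IsScalarTower.of_algebraMap_eq fun _ => rfl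
    have hsep : Algebra.IsSeparable N K := Algebra.isSeparable_tower_top_of_isSeparable E N K
    have hchN : CharP N p := (RingHom.charP_iff (algebraMap N K) (algebraMap N K).injective p).mpr
      inferInstance
    have hins : IsPurelyInseparable N K := (isPurelyInseparable_iff_pow_mem N p).mpr fun z =>
      ⟨1, ⟨z ^ p, hpow z⟩, by rw [pow_one]; rfl⟩
    refine eq_top_iff.mpr fun z _ => ?_
    obtain ⟨n, rfl⟩ := IsPurelyInseparable.surjective_algebraMap_of_isSeparable N K z
    exact n.2
  · rw [← Set.image_univ, hyinj.encard_image, Set.encard_univ]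

/-- A perfect field `L` of characteristic `p` with a transcendence basis of at least `I` elements
is a purely inseparable extension of a field of elementary imperfection degree `I`. -/
theorem exists_isPurelyInseparable_hasElementaryImperfectionDegree {L : Type u} [Field L]
    [CharP L p] [PerfectRing L p] [Algebra (ZMod p) L] {τ : Type*} {x : τ → L}
    (hx : IsTranscendenceBasis (ZMod p) x) {I : ℕ∞} (hI : I ≤ ENat.card τ) :
    ∃ (K : Type u) (_ : Field K) (_ : Algebra K L), IsPurelyInseparable K L ∧
      HasElementaryImperfectionDegree K p I := by
  have hp := (Fact.out : p.Prime)
  rw [← Set.encard_univ] at hI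
  obtain ⟨t, -, rfl⟩ := Set.exists_subset_encard_eq hI
  have h1 : AlgebraicIndependent (Algebra.adjoin (ZMod p) (x '' tᶜ)) (fun i : t => x i) :=
    hx.1.adjoin_of_disjoint disjoint_compl_left
  have h1' := algebraicIndependent_adjoin_iff.mpr h1
  set F := adjoin (ZMod p) (x '' tᶜ) with hF
  have h2 : AlgebraicIndependent (algebraicClosure F L) (fun i : t => x i) :=
    h1'.extendScalars _
  set P := algebraicClosure F L with hP
  have hPperf : ∀ a : P, ∃ b, b ^ p = a := by
    intro a
    obtain ⟨b, hb⟩ := surjective_frobenius L p (a : L)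
    rw [frobenius_def] at hb
    refine ⟨⟨b, mem_algebraicClosure_iff.mpr (IsAlgebraic.of_pow hp.pos (n := p) ?_)⟩, Subtype.ext hb⟩
    rw [hb]
    exact mem_algebraicClosure_iff.mp a.2
  have halg : Algebra.IsAlgebraic (adjoin P (Set.range fun i : t => x i)) L := by
    have := hx.isAlgebraic_field
    set E := adjoin P (Set.range fun i : t => x i) with hE
    have hle : ∀ z ∈ adjoin (ZMod p) (Set.range x), z ∈ E := by
      have : adjoin (ZMod p) (Set.range x) ≤ (E.restrictScalars F).restrictScalars (ZMod p) := by
        refine adjoin_le_iff.mpr ?_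
        rintro _ ⟨i, rfl⟩
        by_cases hi : i ∈ t
        · exact subset_adjoin P _ ⟨⟨i, hi⟩, rfl⟩
        · have h3 : x i ∈ F := subset_adjoin _ _ ⟨i, hi, rfl⟩
          have h4 : x i ∈ P := P.algebraMap_mem (⟨x i, h3⟩ : F)
          exact E.algebraMap_mem (⟨x i, h4⟩ : P)
      exact fun z hz => this hz
    let _ : Algebra (adjoin (ZMod p) (Set.range x)) E :=
      ((algebraMap (adjoin (ZMod p) (Set.range x)) L).codRestrict E fun z => hle z z.2).toAlgebra
    have : IsScalarTower (adjoin (ZMod p) (Set.range x)) E L :=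
      IsScalarTower.of_algebraMap_eq fun _ => rfl
    exact Algebra.IsAlgebraic.tower_top (K := adjoin (ZMod p) (Set.range x)) E
  exact ⟨separableClosure (adjoin P (Set.range fun i : t => x i)) L, inferInstance, inferInstance,
    inferInstance, hasElementaryImperfectionDegree_separableClosure hPperf h2⟩

theorem HasElementaryImperfectionDegree.surjective_algebraMap_of_zero {K L : Type*} [Field K]
    [Field L] [Algebra K L] [CharP K p] [IsPurelyInseparable K L]
    (hK : HasElementaryImperfectionDegree K p 0) : Function.Surjective (algebraMap K L) := by
  obtain ⟨S, ⟨-, hS⟩, hS0⟩ := hK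
  obtain rfl := Set.encard_eq_zero.mp hS0
  have hrange : pSpan p (∅ : Set K) = (frobenius K p).fieldRange := by
    rw [pSpan, Set.union_empty]
    exact Subfield.closure_eq (frobenius K p).fieldRange
  have : PerfectRing K p := PerfectRing.ofSurjective K p fun z => by
    have : z ∈ (frobenius K p).fieldRange := by rw [← hrange, hS]; trivial
    exact this
  have := PerfectRing.toPerfectField K p
  exact IsPurelyInseparable.surjective_algebraMap_of_isSeparable K L

end Imperfection

end SepTame

/-! ### Composita with purely inseparable extensions -/

namespace SepTame

section Compositum

open Polynomial

/-- A finite separable extension `F` and a purely inseparable extension `L` of `K` have a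
compositum `M` with `[M : L] = [F : K]`, which is purely inseparable over `F`. -/
theorem exists_compositum {p : ℕ} [Fact p.Prime] (K : Type u) (F L : Type v) [Field K] [Field F]
    [Field L] [CharP L p] [Algebra K F] [Algebra K L] [FiniteDimensional K F]
    [Algebra.IsSeparable K F] [IsPurelyInseparable K L] :
    ∃ (M : Type v) (_ : Field M) (_ : Algebra F M) (_ : Algebra L M),
      (algebraMap F M).comp (algebraMap K F) = (algebraMap L M).comp (algebraMap K L) ∧
      FiniteDimensional L M ∧ Module.finrank L M = Module.finrank K F ∧
      IsPurelyInseparable F M := by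
  have hchK : CharP K p := (RingHom.charP_iff (algebraMap K L) (algebraMap K L).injective p).mpr
    inferInstance
  have hchF : CharP F p := (RingHom.charP_iff (algebraMap K F) (algebraMap K F).injective p).mp
    inferInstance
  let pb := Field.powerBasisOfFiniteOfSeparable K F
  have hint : IsIntegral K pb.gen := Algebra.IsIntegral.isIntegral _
  set f := minpoly K pb.gen with hf
  set g := f.map (algebraMap K L) with hg
  have hgirr : Irreducible g := Polynomial.Separable.map_irreducible_of_isPurelyInseparable L
    (Algebra.IsSeparable.isSeparable K pb.gen) (minpoly.irreducible hint)
  have : Fact (Irreducible g) := ⟨hgirr⟩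
  have hroot : aeval (AdjoinRoot.root g) (minpoly K pb.gen) = 0 := by
    rw [← hf, aeval_def, IsScalarTower.algebraMap_eq K L (AdjoinRoot g), ← eval₂_map, ← hg]
    exact AdjoinRoot.eval₂_root g
  let φ : F →ₐ[K] AdjoinRoot g := pb.lift (AdjoinRoot.root g) hroot
  have hφ : (φ : F →+* AdjoinRoot g).comp (algebraMap K F) =
      (algebraMap L (AdjoinRoot g)).comp (algebraMap K L) := by
    rw [← IsScalarTower.algebraMap_eq K L]
    exact φ.comp_algebraMap
  let _ : Algebra F (AdjoinRoot g) := (φ : F →+* AdjoinRoot g).toAlgebra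
  refine ⟨AdjoinRoot g, inferInstance, inferInstance, inferInstance, hφ,
    (AdjoinRoot.powerBasis hgirr.ne_zero).finite, ?_, ?_⟩
  · rw [(AdjoinRoot.powerBasis hgirr.ne_zero).finrank, AdjoinRoot.powerBasis_dim, hg,
      natDegree_map, hf, pb.natDegree_minpoly, pb.finrank]
  · rw [isPurelyInseparable_iff_pow_mem F p]
    intro m
    rw [← mem_perfectClosure_iff_pow_mem p]
    induction m using AdjoinRoot.induction_on with
    | ih q =>
      rw [← AdjoinRoot.aeval_eq, aeval_eq_sum_range]
      refine sum_mem fun i _ => ?_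
      rw [Algebra.smul_def]
      refine mul_mem ?_ (pow_mem ?_ i)
      · rw [mem_perfectClosure_iff_pow_mem p]
        obtain ⟨n, a, ha⟩ := IsPurelyInseparable.pow_mem K p (q.coeff i)
        exact ⟨n, algebraMap K F a, by rw [← map_pow, ← ha]; exact RingHom.congr_fun hφ a⟩
      · have : AdjoinRoot.root g = algebraMap F (AdjoinRoot g) pb.gen :=
          (pb.lift_gen _ hroot).symm
        rw [this]
        exact (perfectClosure F (AdjoinRoot g)).algebraMap_mem _

end Compositum

section PurelyInseparable

variable {F : Type u} [Field F] {M : Type v} [Field M] [Algebra F M]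

theorem pow_char_pow_mem_iff {p : ℕ} [Fact p.Prime] (B : ValuationSubring F) {x : F} (n : ℕ) :
    x ^ p ^ n ∈ B ↔ x ∈ B := by
  rw [← ValuationSubring.valuation_le_one_iff, ← ValuationSubring.valuation_le_one_iff, map_pow]
  exact pow_le_one_iff_of_nonneg zero_le
    (pow_ne_zero n (Fact.out : p.Prime).ne_zero)

/-- The extension of the valuation ring `B` of `F` to a purely inseparable extension `M` of `F`: it
consists of the elements which have a `p ^ n`-th power in `B`. -/
def radicialExtension (p : ℕ) [Fact p.Prime] [CharP M p] [CharP F p] [IsPurelyInseparable F M]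
    (B : ValuationSubring F) : ValuationSubring M where
  carrier := {x | ∃ n : ℕ, ∃ b ∈ B, algebraMap F M b = x ^ p ^ n}
  mul_mem' := by
    rintro x y ⟨n, b, hb, hbx⟩ ⟨m, c, hc, hcy⟩
    refine ⟨n + m, b ^ p ^ m * c ^ p ^ n, mul_mem (pow_mem hb _) (pow_mem hc _), ?_⟩
    rw [map_mul, map_pow, map_pow, hbx, hcy, mul_pow, ← pow_mul, ← pow_mul, ← pow_add, ← pow_add,
      add_comm m n]
  one_mem' := ⟨0, 1, one_mem B, by simp⟩
  add_mem' := by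
    rintro x y ⟨n, b, hb, hbx⟩ ⟨m, c, hc, hcy⟩
    refine ⟨n + m, b ^ p ^ m + c ^ p ^ n, add_mem (pow_mem hb _) (pow_mem hc _), ?_⟩
    rw [map_add, map_pow, map_pow, hbx, hcy, add_pow_char_pow, ← pow_mul, ← pow_mul, ← pow_add,
      ← pow_add, add_comm m n]
  zero_mem' := ⟨0, 0, zero_mem B, by simp⟩
  neg_mem' := by
    rintro x ⟨n, b, hb, hbx⟩
    refine ⟨n, -b, neg_mem hb, ?_⟩
    have h1 := sub_pow_char_pow (0 : M) x n (p := p)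
    rw [zero_sub, zero_pow (pow_ne_zero n (Fact.out : p.Prime).ne_zero), zero_sub] at h1
    rw [map_neg, hbx, h1]
  mem_or_inv_mem' := by
    intro x
    obtain ⟨n, b, hb⟩ := IsPurelyInseparable.pow_mem F p x
    rcases B.mem_or_inv_mem b with h | h
    · exact Or.inl ⟨n, b, h, hb⟩
    · exact Or.inr ⟨n, b⁻¹, h, by rw [map_inv₀, hb, inv_pow]⟩

variable {p : ℕ} [Fact p.Prime] [CharP M p] [CharP F p] [IsPurelyInseparable F M]

theorem mem_radicialExtension_iff {B : ValuationSubring F} {x : M} {n : ℕ} {b : F}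
    (hb : algebraMap F M b = x ^ p ^ n) : x ∈ radicialExtension p B ↔ b ∈ B := by
  refine ⟨?_, fun h => ⟨n, b, h, hb⟩⟩
  rintro ⟨m, c, hc, hcx⟩
  have h1 : b ^ p ^ m = c ^ p ^ n := (algebraMap F M).injective (by
    rw [map_pow, map_pow, hb, hcx, ← pow_mul, ← pow_mul, mul_comm])
  rw [← pow_char_pow_mem_iff (p := p) B m, h1]
  exact pow_mem hc _

theorem liesOver_radicialExtension (B : ValuationSubring F) :
    LiesOver B (radicialExtension (M := M) p B) := by
  ext x
  rw [ValuationSubring.mem_comap]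
  exact mem_radicialExtension_iff (n := 0) (by simp)

end PurelyInseparable

end SepTame

/-! ### Descent of defectlessness -/

namespace SepTame

section Descent

variable {p : ℕ} [Fact p.Prime]

/-- If every leading term of `L` is attained on `K`, the residue fields agree. -/
theorem residueMap_surjective_of_approx {K L : Type*} [Field K] [Field L] [Algebra K L]
    {A : ValuationSubring K} {A' : ValuationSubring L} (h : LiesOver A A')
    (happ : ∀ l : L, l ≠ 0 → ∃ x : K, A'.valuation (algebraMap K L x - l) < A'.valuation l) :
    Function.Surjective (residueMap A A' h) := by
  intro r
  obtain ⟨l, rfl⟩ := IsLocalRing.residue_surjective r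
  rcases eq_or_ne (l : L) 0 with h0 | h0
  · exact ⟨0, by rw [map_zero, show l = 0 from Subtype.ext h0, map_zero]⟩
  obtain ⟨x, hx⟩ := happ l h0
  have hx1 : A'.valuation (algebraMap K L x - l) < 1 := hx.trans_le (A'.valuation_le_one l)
  have hxA : x ∈ A := by
    rw [← h.algebraMap_mem_iff, ← sub_add_cancel (algebraMap K L x) l]
    exact add_mem ((A'.valuation_le_one_iff _).mp hx1.le) l.2
  refine ⟨IsLocalRing.residue A ⟨x, hxA⟩, ?_⟩
  rw [residueMap_residue, ← sub_eq_zero, ← map_sub, IsLocalRing.residue_eq_zero_iff,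
    ValuationSubring.valuation_lt_one_iff]
  exact hx1

theorem charP_residueField {K : Type*} [Field K] [CharP K p] (A : ValuationSubring K) :
    CharP (IsLocalRing.ResidueField A) p := by
  rw [CharP.charP_iff_prime_eq_zero Fact.out]
  have : ((p : A) : K) = 0 := by simp
  rw [← map_natCast (IsLocalRing.residue A), show (p : A) = 0 from Subtype.ext this, map_zero]

variable {K F L M : Type*} [Field K] [Field F] [Field L] [Field M] [Algebra K F] [Algebra K L]
  [Algebra F M] [Algebra L M] [CharP F p] [CharP M p] [IsPurelyInseparable F M]
  {A : ValuationSubring K} {A' : ValuationSubring L} {B : ValuationSubring F}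

theorem liesOver_radicialExtension_of_liesOver [CharP L p] [IsPurelyInseparable K L]
    (hcomm : (algebraMap F M).comp (algebraMap K F) = (algebraMap L M).comp (algebraMap K L))
    (hA : LiesOver A A') (hB : LiesOver A B) : LiesOver A' (radicialExtension (M := M) p B) := by
  have hchK : CharP K p := (RingHom.charP_iff (algebraMap K L) (algebraMap K L).injective p).mpr
    inferInstance
  ext l
  obtain ⟨n, x, hx⟩ := IsPurelyInseparable.pow_mem K p l
  have h1 : algebraMap F M (algebraMap K F x) = algebraMap L M l ^ p ^ n := by
    rw [← map_pow, ← hx]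
    exact RingHom.congr_fun hcomm x
  rw [ValuationSubring.mem_comap, mem_radicialExtension_iff h1, hB.algebraMap_mem_iff,
    ← hA.algebraMap_mem_iff, hx, pow_char_pow_mem_iff]

/-- The residue field of the radicial extension of `B` is that of `B`: it is purely inseparable over
it, and separable since it is algebraic over the perfect residue field of `A`. -/
theorem inertiaDegree_radicialExtension [PerfectField (IsLocalRing.ResidueField A)]
    (hcomm : (algebraMap F M).comp (algebraMap K F) = (algebraMap L M).comp (algebraMap K L))
    (hA : LiesOver A A') (hB : LiesOver A B)
    (happ : ∀ l : L, l ≠ 0 → ∃ x : K, A'.valuation (algebraMap K L x - l) < A'.valuation l)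
    (hM : LiesOver A' (radicialExtension (M := M) p B))
    (hfin : inertiaDegree A' (radicialExtension (M := M) p B) hM ≠ 0) :
    inertiaDegree A B hB = inertiaDegree A' (radicialExtension (M := M) p B) hM := by
  set B' := radicialExtension (M := M) p B with hB'
  have hBB' : LiesOver B B' := liesOver_radicialExtension B
  let _ := (residueMap A A' hA).toAlgebra
  let _ := (residueMap A B hB).toAlgebra
  let _ := (residueMap A' B' hM).toAlgebra
  let _ := (residueMap B B' hBB').toAlgebra
  let _ := ((residueMap B B' hBB').comp (residueMap A B hB)).toAlgebra
  have hcomp : (residueMap B B' hBB').comp (residueMap A B hB) =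
      (residueMap A' B' hM).comp (residueMap A A' hA) := by
    refine RingHom.ext fun r => ?_
    obtain ⟨a, rfl⟩ := IsLocalRing.residue_surjective r
    simp only [RingHom.comp_apply, residueMap_residue]
    congr 1
    exact Subtype.ext (RingHom.congr_fun hcomm a)
  have : IsScalarTower (IsLocalRing.ResidueField A) (IsLocalRing.ResidueField B)
      (IsLocalRing.ResidueField B') := IsScalarTower.of_algebraMap_eq fun _ => rfl
  have : IsScalarTower (IsLocalRing.ResidueField A) (IsLocalRing.ResidueField A')
      (IsLocalRing.ResidueField B') :=
    IsScalarTower.of_algebraMap_eq fun r => RingHom.congr_fun hcomp r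
  have hsurj : Function.Surjective (residueMap A A' hA) := residueMap_surjective_of_approx hA happ
  have : FiniteDimensional (IsLocalRing.ResidueField A') (IsLocalRing.ResidueField B') :=
    Module.finite_of_finrank_pos (Nat.pos_of_ne_zero hfin)
  have : Algebra.IsAlgebraic (IsLocalRing.ResidueField A) (IsLocalRing.ResidueField A') :=
    ⟨fun r => by
      obtain ⟨a, rfl⟩ := hsurj r
      exact isAlgebraic_algebraMap a⟩
  have : Algebra.IsAlgebraic (IsLocalRing.ResidueField A) (IsLocalRing.ResidueField B') :=
    Algebra.IsAlgebraic.trans _ (IsLocalRing.ResidueField A') _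
  have : Algebra.IsSeparable (IsLocalRing.ResidueField A) (IsLocalRing.ResidueField B') :=
    Algebra.IsAlgebraic.isSeparable_of_perfectField
  have : Algebra.IsSeparable (IsLocalRing.ResidueField B) (IsLocalRing.ResidueField B') :=
    Algebra.isSeparable_tower_top_of_isSeparable (IsLocalRing.ResidueField A) _ _
  have hch : CharP (IsLocalRing.ResidueField B) p := charP_residueField B
  have : IsPurelyInseparable (IsLocalRing.ResidueField B) (IsLocalRing.ResidueField B') := by
    rw [isPurelyInseparable_iff_pow_mem _ p]
    intro r
    obtain ⟨x, rfl⟩ := IsLocalRing.residue_surjective r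
    obtain ⟨n, b, hb, hbx⟩ := x.2
    exact ⟨n, IsLocalRing.residue B ⟨b, hb⟩, congrArg (IsLocalRing.residue B')
      (show ringMap B B' hBB' ⟨b, hb⟩ = x ^ p ^ n from Subtype.ext hbx)⟩
  have hbij : Function.Bijective (residueMap B B' hBB') :=
    IsPurelyInseparable.bijective_algebraMap_of_isSeparable _ _
  exact Algebra.finrank_eq_of_equiv_equiv
    (RingEquiv.ofBijective (residueMap A A' hA) ⟨(residueMap A A' hA).injective, hsurj⟩)
    (RingEquiv.ofBijective (residueMap B B' hBB') hbij) hcomp.symm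

/-- The ramification index does not change: an element of `M` has a `p ^ n`-th power in `F`, and
raising to the `p`-th power is a permutation of the finite quotient of the value groups of `M`
and `L`, as `L` is perfect. -/
theorem ramificationIndex_radicialExtension [CharP L p] [PerfectRing L p]
    (hcomm : (algebraMap F M).comp (algebraMap K F) = (algebraMap L M).comp (algebraMap K L))
    (happ : ∀ l : L, l ≠ 0 → ∃ x : K, A'.valuation (algebraMap K L x - l) < A'.valuation l)
    (hM : LiesOver A' (radicialExtension (M := M) p B))
    (hfin : ramificationIndex L (radicialExtension (M := M) p B) ≠ 0) :
    ramificationIndex K B = ramificationIndex L (radicialExtension (M := M) p B) := by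
  have hp := (Fact.out : p.Prime)
  set B' := radicialExtension (M := M) p B with hB'
  have hBB' : LiesOver B B' := liesOver_radicialExtension B
  unfold ramificationIndex at hfin ⊢
  set G := (Units.map (algebraMap K F : K →* F)).range ⊔ B.unitGroup with hG
  set G' := (Units.map (algebraMap L M : L →* M)).range ⊔ B'.unitGroup with hG'
  have hcomm' : ∀ x, algebraMap F M (algebraMap K F x) = algebraMap L M (algebraMap K L x) :=
    RingHom.congr_fun hcomm
  have hGG' : G = G'.comap (Units.map (algebraMap F M : F →* M)) := by
    ext x
    rw [Subgroup.mem_comap, mem_range_sup_unitGroup_iff, mem_range_sup_unitGroup_iff]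
    constructor
    · rintro ⟨a, ha, hax⟩
      refine ⟨algebraMap K L a, by simpa using ha, ?_⟩
      rw [← hcomm']
      exact le_antisymm (hBB'.valuation_le_iff.mpr hax.le) (hBB'.valuation_le_iff.mpr hax.ge)
    · rintro ⟨l, hl, hlx⟩
      obtain ⟨a, ha⟩ := happ l hl
      have hal : A'.valuation (algebraMap K L a) = A'.valuation l :=
        Valuation.map_eq_of_sub_lt _ ha
      have ha0 : a ≠ 0 := by
        rintro rfl
        rw [map_zero, map_zero] at hal
        exact hl ((Valuation.zero_iff _).mp hal.symm)
      have h1 : B'.valuation (algebraMap F M x) = B'.valuation (algebraMap F M (algebraMap K F a)) := by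
        rw [hcomm']
        exact hlx.trans (le_antisymm (hM.valuation_le_iff.mpr hal.ge)
          (hM.valuation_le_iff.mpr hal.le))
      exact ⟨a, ha0, le_antisymm (hBB'.valuation_le_iff.mp h1.le) (hBB'.valuation_le_iff.mp h1.ge)⟩
  have hinj : Function.Injective (fun q : Mˣ ⧸ G' => q ^ p) := by
    intro q q' hqq
    induction q using QuotientGroup.induction_on with
    | H x =>
      induction q' using QuotientGroup.induction_on with
      | H y =>
        simp only [← QuotientGroup.mk_pow] at hqq
        rw [QuotientGroup.eq, ← inv_pow, ← mul_pow, mem_range_sup_unitGroup_iff] at hqq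
        rw [QuotientGroup.eq, mem_range_sup_unitGroup_iff]
        obtain ⟨l, hl, hlx⟩ := hqq
        obtain ⟨l, rfl⟩ := surjective_frobenius L p l
        rw [frobenius_def, map_pow, map_pow, Units.val_pow_eq_pow_val, map_pow] at hlx
        refine ⟨l, ?_, (pow_left_inj₀ zero_le zero_le hp.ne_zero).mp hlx⟩
        rintro rfl
        simp [frobenius_def, hp.ne_zero] at hl
  have hQ : Finite (Mˣ ⧸ G') := Nat.finite_of_card_ne_zero hfin
  have hsup : (Units.map (algebraMap F M : F →* M)).range ⊔ G' = ⊤ := by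
    refine eq_top_iff.mpr fun x _ => ?_
    obtain ⟨N, hN, hper⟩ := hinj.mem_periodicPts (x : Mˣ ⧸ G')
    obtain ⟨n, a, ha⟩ := IsPurelyInseparable.pow_mem F p (x : M)
    have h1 : ((x : Mˣ ⧸ G')) ^ p ^ (N * n) = x := by
      have := (hper.mul_const n)
      rw [Function.IsPeriodicPt, Function.IsFixedPt, pow_iterate] at this
      exact this
    have ha0 : a ≠ 0 := by
      rintro rfl
      rw [map_zero] at ha
      exact pow_ne_zero _ x.ne_zero ha.symm
    obtain ⟨m, hm⟩ := Nat.exists_eq_add_of_le (Nat.le_mul_of_pos_left n hN)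
    have h2 : x ^ p ^ (N * n) ∈ (Units.map (algebraMap F M : F →* M)).range := by
      refine ⟨Units.mk0 a ha0 ^ p ^ m, Units.ext ?_⟩
      rw [map_pow, Units.val_pow_eq_pow_val, Units.val_pow_eq_pow_val, hm, pow_add, pow_mul, ← ha]
      rfl
    have h3 : (x ^ p ^ (N * n))⁻¹ * x ∈ G' := by
      rw [← QuotientGroup.eq, QuotientGroup.mk_pow, h1]
    rw [← mul_inv_cancel_left (x ^ p ^ (N * n)) x]
    exact Subgroup.mul_mem_sup h2 h3
  rw [hGG', Subgroup.index_comap, ← Subgroup.relIndex_sup_right, hsup, Subgroup.relIndex_top_right]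

end Descent

/-- Let `L` be perfect and maximally complete, purely inseparable over `K`, with perfect residue
field and all leading terms attained on `K` (so that value groups and residue fields agree). Then `K` is separably defectless: a finite
separable extension `F` of `K` has the same degree, ramification index and inertia degree as the
compositum of `F` and `L` over `L`. -/
theorem isSeparablyDefectless_of_isPurelyInseparable {p : ℕ} [Fact p.Prime] {K L : Type u}
    [Field K] [Field L] [Algebra K L] [CharP L p] [PerfectRing L p] [IsPurelyInseparable K L]
    {A : ValuationSubring K} {A' : ValuationSubring L} (hA : LiesOver A A')
    (hmax : IsMaximallyComplete A') [PerfectField (IsLocalRing.ResidueField A)]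
    (happ : ∀ l : L, l ≠ 0 → ∃ x : K, A'.valuation (algebraMap K L x - l) < A'.valuation l) :
    IsSeparablyDefectless A := by
  intro F _ _ _ _ B hB
  obtain ⟨M, _, _, _, hcomm, _, hfin, _⟩ := exists_compositum (p := p) K F L
  have hchM : CharP M p := (RingHom.charP_iff (algebraMap L M) (algebraMap L M).injective p).mp
    inferInstance
  have hchF : CharP F p := (RingHom.charP_iff (algebraMap F M) (algebraMap F M).injective p).mpr
    inferInstance
  have hM := liesOver_radicialExtension_of_liesOver (p := p) hcomm hA hB
  have heq := hmax.finrank_eq hM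
  have hpos : Module.finrank L M ≠ 0 := Module.finrank_pos.ne'
  rw [heq] at hpos
  rw [← hfin, heq, inertiaDegree_radicialExtension hcomm hA hB happ hM (right_ne_zero_of_mul hpos),
    ramificationIndex_radicialExtension hcomm happ hM (left_ne_zero_of_mul hpos)]

end SepTame

/-! ### Descent of henselianity, transcendence degree and residue field of Hahn series fields -/

namespace SepTame

section Henselian

open Polynomial

theorem isUnit_add_of_mem_maximalIdeal {R : Type*} [CommRing R] [IsLocalRing R] {a b : R}
    (ha : IsUnit a) (hb : b - a ∈ IsLocalRing.maximalIdeal R) : IsUnit b := by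
  by_contra h
  have h1 : b ∈ IsLocalRing.maximalIdeal R := (IsLocalRing.mem_maximalIdeal b).mpr h
  exact (IsLocalRing.mem_maximalIdeal a).mp (by simpa using Ideal.sub_mem _ h1 hb) ha

/-- Henselianity descends along purely inseparable extensions, as simple roots are separable. -/
theorem henselianLocalRing_of_isPurelyInseparable {K L : Type*} [Field K] [Field L] [Algebra K L]
    [IsPurelyInseparable K L] {A : ValuationSubring K} {A' : ValuationSubring L}
    (h : LiesOver A A') (hA' : HenselianLocalRing A') : HenselianLocalRing A where
  is_henselian := by
    intro f hf a₀ h₀ hu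
    set φ := ringMap A A' h with hφ
    have hmem : ∀ a : A, φ a ∈ IsLocalRing.maximalIdeal A' ↔ a ∈ IsLocalRing.maximalIdeal A := by
      intro a
      rw [ValuationSubring.valuation_lt_one_iff, ValuationSubring.valuation_lt_one_iff]
      have := h.valuation_lt_iff (x := (a : K)) (y := 1)
      rwa [map_one, map_one, map_one] at this
    obtain ⟨y, hy, hya⟩ := HenselianLocalRing.is_henselian (f.map φ) (hf.map φ) (φ a₀)
      (by rw [eval_map, eval₂_hom]; exact (hmem _).mpr h₀)
      (by rw [derivative_map, eval_map, eval₂_hom]; exact hu.map φ)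
    have hy' : IsUnit ((f.map φ).derivative.eval y) := by
      refine isUnit_add_of_mem_maximalIdeal (a := (f.map φ).derivative.eval (φ a₀)) ?_ ?_
      · rw [derivative_map, eval_map, eval₂_hom]
        exact hu.map φ
      · obtain ⟨d, hd⟩ := (f.map φ).derivative.sub_dvd_eval_sub y (φ a₀)
        rw [hd]
        exact Ideal.mul_mem_right _ _ hya
    have hcomp : (algebraMap K L).comp A.subtype = A'.subtype.comp φ := rfl
    have haeval : ∀ g : A[X], aeval (y : L) (g.map A.subtype) = A'.subtype ((g.map φ).eval y) := by
      intro g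
      rw [aeval_def, eval₂_map, hcomp, ← eval₂_map, ← eval₂_hom]
      rfl
    obtain ⟨x, hx⟩ : (y : L) ∈ (algebraMap K L).range := by
      refine mem_range_algebraMap_of_simple_root (f := f.map A.subtype) ?_ ?_
      · rw [haeval, hy.eq_zero, map_zero]
      · rw [derivative_map, haeval, ← derivative_map]
        exact fun h0 => hy'.ne_zero (Subtype.ext h0)
    have hxA : x ∈ A := by
      rw [← h.algebraMap_mem_iff, hx]
      exact y.2
    have hxy : φ ⟨x, hxA⟩ = y := Subtype.ext hx
    have hinj : Function.Injective φ := fun a b hab =>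
      Subtype.ext ((algebraMap K L).injective (congrArg Subtype.val hab))
    refine ⟨⟨x, hxA⟩, hinj ?_, ?_⟩
    · rw [← hxy, IsRoot.def, eval_map, eval₂_hom] at hy
      rw [hy, map_zero]
    · rw [← hmem, map_sub, hxy]
      exact hya

end Henselian

section TranscendenceDegree

open HahnSeries

variable {k : Type u} [Field k] {Γ : Type v} [AddCommGroup Γ] [LinearOrder Γ]
  [IsOrderedAddMonoid Γ]

theorem uncountable_hahnSeries [Nontrivial Γ] : Uncountable (HahnSeries Γ k) := by
  classical
  obtain ⟨ε, hε⟩ := exists_zero_lt (α := Γ)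
  let e : ℕ ↪o Γ := OrderEmbedding.ofStrictMono (fun n => n • ε) fun m n hmn =>
    nsmul_lt_nsmul_left hε hmn
  let f : Set ℕ → HahnSeries Γ k := fun s =>
    embDomain e ⟨fun n => if n ∈ s then 1 else 0, Set.isPWO_of_wellQuasiOrderedLE _⟩
  have hf : Function.Injective f := by
    intro s t hst
    have h1 := embDomain_injective hst
    ext n
    have h2 := congrArg (fun x : HahnSeries ℕ k => x.coeff n) h1
    by_cases hs : n ∈ s <;> by_cases ht : n ∈ t <;> simp_all
  rw [uncountable_iff_not_countable]
  intro hc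
  obtain ⟨g, hg⟩ := hc.exists_injective_nat
  exact Function.cantor_injective (g ∘ f) (hg.comp hf)

theorem countable_of_isTranscendenceBasis {F L τ : Type*} [Field F] [Countable F] [Field L]
    [Algebra F L] [Countable τ] {x : τ → L} (hx : IsTranscendenceBasis F x) : Countable L := by
  have h1 : Countable (MvPolynomial τ F) := by
    rw [← Cardinal.mk_le_aleph0_iff]
    refine MvPolynomial.cardinalMk_le_max_lift.trans ?_
    simp
  have h2 : Countable (Algebra.adjoin F (Set.range x)) :=
    hx.1.aevalEquiv.symm.injective.countable
  have := hx.isAlgebraic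
  have h3 := Algebraic.countable (Algebra.adjoin F (Set.range x)) L
  rw [← Set.countable_univ_iff]
  exact h3.mono fun l _ => Algebra.IsAlgebraic.isAlgebraic l

end TranscendenceDegree

section Main

open HahnSeries

variable {k : Type u} [Field k] {Γ : Type v} [AddCommGroup Γ] [LinearOrder Γ]
  [IsOrderedAddMonoid Γ]

variable (k Γ) in
/-- The residue field of the Hahn series field `k((Γ))` is `k`. -/
theorem nonempty_residueField_hahnSeries_equiv :
    Nonempty (IsLocalRing.ResidueField (valuationRing (addVal Γ k)) ≃+* k) := by
  have hC : ∀ c : k, C c ∈ valuationRing (addVal Γ k) := by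
    intro c
    change 0 ≤ addVal Γ k _
    rw [addVal_apply]
    exact orderTop_single_le
  let φ : k →+* IsLocalRing.ResidueField (valuationRing (addVal Γ k)) :=
    (IsLocalRing.residue _).comp ((C : k →+* HahnSeries Γ k).codRestrict _ hC)
  refine ⟨(RingEquiv.ofBijective φ ⟨φ.injective, fun r => ?_⟩).symm⟩
  obtain ⟨a, rfl⟩ := IsLocalRing.residue_surjective r
  refine ⟨(a : HahnSeries Γ k).coeff 0, ?_⟩
  rw [← sub_eq_zero]
  change IsLocalRing.residue _ (⟨C ((a : HahnSeries Γ k).coeff 0), hC _⟩ : valuationRing (addVal Γ k))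
    - IsLocalRing.residue _ a = 0
  rw [← map_sub, IsLocalRing.residue_eq_zero_iff, ValuationSubring.valuation_lt_one_iff,
    ← map_one (valuationRing (addVal Γ k)).valuation, valuation_valuationRing_lt_iff,
    AddValuation.map_one, addVal_apply, ← WithTop.coe_zero, coe_lt_orderTop_iff]
  intro δ hδ
  rw [AddSubgroupClass.coe_sub, coeff_sub]
  rcases hδ.lt_or_eq with hδ | rfl
  · have ha : 0 ≤ addVal Γ k (a : HahnSeries Γ k) := a.2
    rw [addVal_apply] at ha
    have h1 : (a : HahnSeries Γ k).coeff δ = 0 :=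
      coeff_eq_zero_of_lt_orderTop ((WithTop.coe_lt_coe.mpr hδ).trans_le ha)
    rw [h1, sub_zero]
    exact coeff_single_of_ne hδ.ne
  · rw [sub_eq_zero]
    exact coeff_single_same _ _

end Main

end SepTame

theorem mainTheorem12 (p : ℕ) (hp : p.Prime) (I : ℕ∞)
    (k : Type u) [Field k] [CharP k p] [PerfectField k]
    (Γ : Type v) [AddCommGroup Γ] [LinearOrder Γ] [IsOrderedAddMonoid Γ]
    (hΓ : ∀ γ : Γ, ∃ δ : Γ, p • δ = γ)
    (hI : I = 0 ∨ Nontrivial Γ) :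
    ∃ (K : Type (max u v)) (_ : Field K) (v : AddValuation K (WithTop Γ)),
      CharP K p ∧
      SepTame.IsSeparablyTame (SepTame.valuationRing v) ∧
      SepTame.HasElementaryImperfectionDegree K p I ∧
      Nonempty (IsLocalRing.ResidueField (SepTame.valuationRing v) ≃+* k) ∧
      Function.Surjective v := by
  have : Fact p.Prime := ⟨hp⟩
  have hperf : PerfectRing (HahnSeries Γ k) p := SepTame.perfectRing_hahnSeries p hΓ
  let _ : Algebra (ZMod p) (HahnSeries Γ k) := ZMod.algebra _ p
  obtain ⟨τ, x, hx⟩ := exists_isTranscendenceBasis' (ZMod p) (HahnSeries Γ k)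
  have hIτ : I ≤ ENat.card τ := by
    rcases hI with rfl | hI
    · exact zero_le
    · have : Infinite τ := by
        by_contra hfin
        rw [not_infinite_iff_finite] at hfin
        have h1 : Countable (HahnSeries Γ k) := SepTame.countable_of_isTranscendenceBasis hx
        exact not_countable_iff.mpr SepTame.uncountable_hahnSeries h1
      rw [ENat.card_eq_top_of_infinite]
      exact le_top
  obtain ⟨K, _, _, _, hKI⟩ :=
    SepTame.exists_isPurelyInseparable_hasElementaryImperfectionDegree hx hIτ
  have hchK : CharP K p := (RingHom.charP_iff (algebraMap K (HahnSeries Γ k))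
    (algebraMap K (HahnSeries Γ k)).injective p).mpr inferInstance
  have happ : ∀ l : HahnSeries Γ k, l ≠ 0 → ∃ x : K,
      HahnSeries.addVal Γ k l <
        HahnSeries.addVal Γ k (algebraMap K (HahnSeries Γ k) x - l) := by
    intro l hl
    rcases hI with rfl | hI
    · obtain ⟨x, rfl⟩ := hKI.surjective_algebraMap_of_zero (L := HahnSeries Γ k) l
      refine ⟨x, ?_⟩
      rw [sub_self, AddValuation.map_zero, lt_top_iff_ne_top, Ne, AddValuation.top_iff]
      exact hl
    · exact SepTame.exists_lt_orderTop_algebraMap_sub hΓ hl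
  set v : AddValuation K (WithTop Γ) :=
    (HahnSeries.addVal Γ k).comap (algebraMap K (HahnSeries Γ k)) with hv
  have hA : SepTame.LiesOver (SepTame.valuationRing v)
      (SepTame.valuationRing (HahnSeries.addVal Γ k)) := rfl
  have happ' : ∀ l : HahnSeries Γ k, l ≠ 0 → ∃ x : K,
      (SepTame.valuationRing (HahnSeries.addVal Γ k)).valuation
          (algebraMap K (HahnSeries Γ k) x - l) <
        (SepTame.valuationRing (HahnSeries.addVal Γ k)).valuation l := fun l hl => by
    obtain ⟨x, hx⟩ := happ l hl
    exact ⟨x, (SepTame.valuation_valuationRing_lt_iff _).mpr hx⟩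
  have hsurj : Function.Surjective v := by
    intro γ
    induction γ using WithTop.recTopCoe with
    | top => exact ⟨0, AddValuation.map_zero _⟩
    | coe γ =>
      obtain ⟨x, hx⟩ := happ (HahnSeries.single γ 1) (HahnSeries.single_ne_zero one_ne_zero)
      refine ⟨x, (AddValuation.map_eq_of_lt_sub _ hx).trans ?_⟩
      rw [HahnSeries.addVal_apply, HahnSeries.orderTop_single one_ne_zero]
  have hmax := SepTame.isMaximallyComplete_hahnSeries k Γ
  obtain ⟨e⟩ := SepTame.nonempty_residueField_hahnSeries_equiv k Γ
  let e' : IsLocalRing.ResidueField (SepTame.valuationRing v) ≃+* k :=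
    (RingEquiv.ofBijective (SepTame.residueMap _ _ hA) ⟨RingHom.injective _,
      SepTame.residueMap_surjective_of_approx hA happ'⟩).trans e
  have hperfk : PerfectField (IsLocalRing.ResidueField (SepTame.valuationRing v)) :=
    PerfectField.of_ringEquiv e'.symm
  have hchk : CharP (IsLocalRing.ResidueField (SepTame.valuationRing v)) p :=
    SepTame.charP_residueField _
  refine ⟨K, inferInstance, v, hchK, ⟨?_, ?_, hperfk, ?_⟩, hKI, ⟨e'⟩, hsurj⟩
  · exact SepTame.henselianLocalRing_of_isPurelyInseparable hA hmax.henselianLocalRing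
  · exact SepTame.isSeparablyDefectless_of_isPurelyInseparable (p := p) hA hmax happ'
  · intro γ
    rw [ringExpChar.eq _ p]
    obtain ⟨x, rfl⟩ := ValuationSubring.valuation_surjective _ γ
    rcases eq_or_ne x 0 with rfl | hx0
    · exact ⟨0, by rw [map_zero, zero_pow hp.ne_zero]⟩
    · obtain ⟨g, hg⟩ := WithTop.ne_top_iff_exists.mp (mt (AddValuation.top_iff v).mp hx0)
      obtain ⟨d, rfl⟩ := hΓ g
      obtain ⟨y, hy⟩ := hsurj (d : WithTop Γ)
      refine ⟨(SepTame.valuationRing v).valuation y, ?_⟩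
      have h1 : v (y ^ p) = v x := by
        rw [AddValuation.map_pow, hy, ← hg, WithTop.coe_nsmul]
      rw [← map_pow]
      exact le_antisymm ((SepTame.valuation_valuationRing_le_iff v).mpr h1.ge)
        ((SepTame.valuation_valuationRing_le_iff v).mpr h1.le)
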